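/- Let $p$ be an odd prime and let $m_1<m_2<m_3<\cdots$ be positive integers. For $n\ge 0$ let $T_n$ be the rooted tree in which every vertex of level $i\ge 0$ has exactly $p^{m_{n+i+1}}$ children, labelled $1,\dots,p^{m_{n+i+1}}$. For $k\ge 0$ and a group $H$ of automorphisms of $T_n$, let $\mathrm{St}_H(k)$ be the subgroup of elements of $H$ that fix every vertex of level $k$. For $n\ge 1$ let $$\psi_1\colon \mathrm{St}_{\mathrm{Aut}\,T_{n-1}}(1)\to \mathrm{Aut}\,T_n\times\overset{p^{m_n}}{\cdots}\times\mathrm{Aut}\,T_n$$ be the isomorphism given by the actions on the subtrees rooted at the first-level vertices $1,\dots,p^{m_n}$. Let $\mathbf e=(e_1,\dots,e_{p^{m_1}-1})$ be a vector of integers, not all zero, with $|e_i|\le p^{m_2}-1$ for all $i$. For $n\ge 0$ let $a_n\in\mathrm{Aut}\,T_n$ be the rooted automorphism that permutes the subtrees rooted at the first-level vertices according to the cycle $(1\,2\,\cdots\,p^{m_{n+1}})$, and let the automorphisms $b_n\in\mathrm{St}_{\mathrm{Aut}\,T_n}(1)$ be defined recursively by $$\psi_1(b_{n-1})=(a_n^{\,e_1},\dots,a_n^{\,e_{p^{m_1}-1}},1,\overset{p^{m_n}-p^{m_1}}{\dots},1,b_n)\qquad(n\ge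 1).$$ Put $G_n=\langle a_n,b_n\rangle$ and let $G=G_0$ be the growing GGS-group defined by $\mathbf e$. Suppose that for all $n\ge 1$ $$\psi_1(G_{n-1}')\ge G_n'\times\overset{p^{m_n}}{\cdots}\times G_n'\qquad\text{and}\qquad \mathrm{St}_{G_{n-1}}(2)\le\langle b_{n-1}^{\,p^{m_n}}\rangle G_{n-1}',$$ and that $\mathbf e$ is non-constant modulo $p$ (that is, $e_i\not\equiv e_j\pmod p$ for some $i,j$). Then $G$ has the $p$-congruence subgroup property: every normal subgroup of $G$ of finite $p$-power index contains $\mathrm{St}_G(n)$ for some $n$. Moreover, for every odd prime $p$ and every such sequence $(m_i)$, the vector $\mathbf e=(1,-1,0,\dots,0)$ satisfies all these hypotheses; hence the corresponding group, the growing Gupta–Sidki group, has the $p$-congruence subgroup property. -/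

import Mathlib

namespace GrowingGGS

/-- `Word q k n`: the vertices of level `n` of the rooted tree `T_k` in which the vertices of level
`i` have `q (k + i)` children, i.e. the words `x₁ x₂ ⋯ x_n` whose `i`-th letter lies in an alphabet
with `q (k + i - 1)` letters. A word of positive length is its first letter followed by a word
of `T_{k+1}`. -/
def Word (q : ℕ → ℕ) : ℕ → ℕ → Type
  | _, 0 => Unit
  | k, n + 1 => Fin (q k) × Word q (k + 1) n

/-- The parent of a vertex: delete the last letter. -/
def Word.parent {q : ℕ → ℕ} : {k n : ℕ} → Word q k (n + 1) → Word q k n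
  | _, 0, _ => ()
  | _, _ + 1, w => (w.1, Word.parent w.2)

/-- The automorphism group of the rooted tree `T_k`: the families of permutations of the layers
that are compatible with the parent maps. -/
def AutT (q : ℕ → ℕ) (k : ℕ) : Subgroup (∀ n, Equiv.Perm (Word q k n)) where
  carrier := {f | ∀ n v, (f (n + 1) v).parent = f n v.parent}
  one_mem' := fun _ _ => rfl
  mul_mem' := by
    intro f g hf hg n v
    simp only [Pi.mul_apply, Equiv.Perm.mul_apply]
    rw [hf, hg]
  inv_mem' := by
    intro f hf n v
    simp only [Pi.inv_apply]
    rw [Equiv.Perm.eq_inv_iff_eq, ← hf]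
    exact congrArg Word.parent ((f (n + 1)).apply_symm_apply v)

/-- `St_{Aut T_k}(n)`: the automorphisms that fix every vertex of level `n`. -/
def levelStab (q : ℕ → ℕ) (k n : ℕ) : Subgroup (AutT q k) where
  carrier := {f | ∀ v, f.1 n v = v}
  one_mem' := fun _ => rfl
  mul_mem' := by
    intro f g hf hg v
    change f.1 n (g.1 n v) = v
    rw [hg, hf]
  inv_mem' := by
    intro f hf v
    change (f.1 n)⁻¹ v = v
    rw [Equiv.Perm.inv_eq_iff_eq, hf]

/-- The automorphism of `T_k` that acts on the first level by `σ` and has section `g x` at the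
first-level vertex `x`. -/
def ofSections {q : ℕ → ℕ} {k : ℕ} (σ : Equiv.Perm (Fin (q k)))
    (g : Fin (q k) → AutT q (k + 1)) : AutT q k :=
  ⟨fun n => match n with
    | 0 => 1
    | n + 1 => Equiv.prodShear σ (fun x => (g x).1 n), by
    intro n v
    match n, v with
    | 0, _ => rfl
    | n + 1, (x, v) => exact Prod.ext rfl ((g x).2 n v)⟩

theorem fst_apply {q : ℕ → ℕ} {k : ℕ} (f : AutT q k) (n : ℕ) (x : Fin (q k))
    (v : Word q (k + 1) n) : (f.1 (n + 1) (x, v)).1 = (f.1 1 (x, ())).1 := by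
  induction n with
  | zero => rfl
  | succ n ih => exact (congrArg Prod.fst (f.2 (n + 1) (x, v))).trans (ih v.parent)

theorem apply_eq {q : ℕ → ℕ} {k : ℕ} {f : AutT q k} (hf : f ∈ levelStab q k 1) (n : ℕ)
    (x : Fin (q k)) (v : Word q (k + 1) n) :
    (x, (f.1 (n + 1) (x, v)).2) = f.1 (n + 1) (x, v) :=
  Prod.ext (((fst_apply f n x v).trans (congrArg Prod.fst (hf (x, ())))).symm) rfl

/-- The section `f_x` at a first-level vertex `x` of an automorphism `f` that fixes the first level:
`f (x v) = x (f_x v)`. -/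
def sectionAt {q : ℕ → ℕ} {k : ℕ} (f : levelStab q k 1) (x : Fin (q k)) : AutT q (k + 1) :=
  ⟨fun n =>
    { toFun := fun v => (f.1.1 (n + 1) (x, v)).2
      invFun := fun v => (f⁻¹.1.1 (n + 1) (x, v)).2
      left_inv := by
        intro v
        change (f⁻¹.1.1 (n + 1) (x, (f.1.1 (n + 1) (x, v)).2)).2 = v
        rw [apply_eq f.2]
        exact congrArg Prod.snd ((f.1.1 (n + 1)).symm_apply_apply (x, v))
      right_inv := by
        intro v
        change (f.1.1 (n + 1) (x, (f⁻¹.1.1 (n + 1) (x, v)).2)).2 = v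
        rw [apply_eq f⁻¹.2]
        exact congrArg Prod.snd ((f.1.1 (n + 1)).apply_symm_apply (x, v)) }, by
    intro n v
    exact congrArg Prod.snd (f.1.2 (n + 1) (x, v))⟩

/-- The isomorphism `ψ₁` from `St_{Aut T_k}(1)` onto `Aut T_{k+1} × ⋯ × Aut T_{k+1}`, with one factor
for each first-level vertex, that sends an automorphism to the tuple of its sections. -/
def psi1 (q : ℕ → ℕ) (k : ℕ) : levelStab q k 1 ≃* (Fin (q k) → AutT q (k + 1)) where
  toFun f := sectionAt f
  invFun g := ⟨ofSections 1 g, fun _ => rfl⟩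
  left_inv := by
    intro f
    apply Subtype.ext
    apply Subtype.ext
    funext n
    match n with
    | 0 => rfl
    | n + 1 => exact Equiv.ext (fun w => apply_eq f.2 n w.1 w.2)
  right_inv _ := rfl
  map_mul' := by
    intro f g
    funext x
    apply Subtype.ext
    funext n
    apply Equiv.ext
    intro v
    change (f.1.1 (n + 1) (g.1.1 (n + 1) (x, v))).2
      = (f.1.1 (n + 1) (x, (g.1.1 (n + 1) (x, v)).2)).2
    rw [apply_eq g.2]

/-- `a_k`: the rooted automorphism of `T_k` given by the cycle `(1 2 ⋯ q_k)`. Here and below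
the letter `j` of the alphabet `{1, …, q_k}` is the element `j - 1` of `Fin (q k)`. -/
def a (q : ℕ → ℕ) (k : ℕ) : AutT q k := ofSections (finRotate (q k)) (fun _ => 1)

/-- The action on level `n` of the directed automorphism `b_k` of `T_k`. -/
def bLevel (q : ℕ → ℕ) (e : Fin (q 0 - 1) → ℤ) : (n k : ℕ) → Equiv.Perm (Word q k n)
  | 0, _ => 1
  | n + 1, k => Equiv.prodShear 1 (fun x : Fin (q k) =>
      if x.val + 1 = q k then bLevel q e n (k + 1)
      else if h : x.val < q 0 - 1 then (a q (k + 1) ^ e ⟨x.val, h⟩).1 n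
      else 1)

/-- `b_k`: the directed automorphism of `T_k` defined recursively by
`ψ₁(b_k) = (a_{k+1}^{e₁}, …, a_{k+1}^{e_{q₀-1}}, 1, …, 1, b_{k+1})`; see `psi1_b`. -/
def b (q : ℕ → ℕ) (e : Fin (q 0 - 1) → ℤ) (k : ℕ) : AutT q k :=
  ⟨fun n => bLevel q e n k, by
    intro n
    induction n generalizing k with
    | zero => intro _; rfl
    | succ n ih =>
      rintro ⟨x, v⟩
      refine Prod.ext rfl ?_
      change Word.parent ((if x.val + 1 = q k then bLevel q e (n + 1) (k + 1)
          else if h : x.val < q 0 - 1 then (a q (k + 1) ^ e ⟨x.val, h⟩).1 (n + 1)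
          else 1 : Equiv.Perm (Word q (k + 1) (n + 1))) v) =
        (if x.val + 1 = q k then bLevel q e n (k + 1)
          else if h : x.val < q 0 - 1 then (a q (k + 1) ^ e ⟨x.val, h⟩).1 n
          else 1 : Equiv.Perm (Word q (k + 1) n)) v.parent
      split_ifs
      · exact ih (k + 1) v
      · exact (a q (k + 1) ^ e _).2 n v
      · rfl⟩

theorem b_mem_levelStab (q : ℕ → ℕ) (e : Fin (q 0 - 1) → ℤ) (k : ℕ) :
    b q e k ∈ levelStab q k 1 := fun _ => rfl

/-- The recursive description of `b_k`. -/
theorem psi1_b (q : ℕ → ℕ) (e : Fin (q 0 - 1) → ℤ) (k : ℕ) (x : Fin (q k)) :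
    psi1 q k ⟨b q e k, b_mem_levelStab q e k⟩ x =
      if x.val + 1 = q k then b q e (k + 1)
      else if h : x.val < q 0 - 1 then a q (k + 1) ^ e ⟨x.val, h⟩
      else 1 := by
  apply Subtype.ext
  funext n
  apply Equiv.ext
  intro v
  change ((if x.val + 1 = q k then bLevel q e n (k + 1)
      else if h : x.val < q 0 - 1 then (a q (k + 1) ^ e ⟨x.val, h⟩).1 n
      else 1 : Equiv.Perm (Word q (k + 1) n))) v = _
  split_ifs <;> rfl

/-- The `k`-th shifted group `G_k = ⟨a_k, b_k⟩ ≤ Aut T_k`; the growing GGS-group itself is `G_0`. -/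
def G (q : ℕ → ℕ) (e : Fin (q 0 - 1) → ℤ) (k : ℕ) : Subgroup (AutT q k) :=
  Subgroup.closure {a q k, b q e k}

/-- The vectors that define a growing GGS-group: not all entries are zero, and all lie in
`{0, ±1, …, ±(q₁ - 1)}`, where `q₁` is the number of children of a first-level vertex. -/
def IsDefiningVector (q : ℕ → ℕ) (e : Fin (q 0 - 1) → ℤ) : Prop :=
  (∃ i, e i ≠ 0) ∧ ∀ i, |e i| ≤ (q 1 : ℤ) - 1

/-- `ψ₁(G_k') ≥ G_{k+1}' × ⋯ × G_{k+1}'` for all `k`. -/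
def DerivedCondition (q : ℕ → ℕ) (e : Fin (q 0 - 1) → ℤ) : Prop :=
  ∀ k, Subgroup.pi Set.univ (fun _ : Fin (q k) => ⁅G q e (k + 1), G q e (k + 1)⁆) ≤
    (⁅G q e k, G q e k⁆.subgroupOf (levelStab q k 1)).map (psi1 q k).toMonoidHom

/-- `St_{G_k}(2) ≤ ⟨b_k ^ q_k⟩ G_k'` for all `k`. -/
def StabCondition (q : ℕ → ℕ) (e : Fin (q 0 - 1) → ℤ) : Prop :=
  ∀ k, G q e k ⊓ levelStab q k 2 ≤ Subgroup.zpowers (b q e k ^ q k) ⊔ ⁅G q e k, G q e k⁆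

/-- The entries of the vector are not all congruent to each other modulo `p`. -/
def NonconstantMod {N : ℕ} (p : ℕ) (e : Fin N → ℤ) : Prop :=
  ∃ i j, ¬ e i ≡ e j [ZMOD p]

/-- The `p`-congruence subgroup property of a group `H` of tree automorphisms: every
normal subgroup of finite `p`-power index in `H` contains some level stabiliser `St_H(n)`. -/
def HasPCongruenceSubgroupProperty (p : ℕ) {q : ℕ → ℕ} {k : ℕ} (H : Subgroup (AutT q k)) : Prop :=
  ∀ N : Subgroup H, N.Normal → (∃ j : ℕ, N.index = p ^ j) →
    ∃ n : ℕ, (levelStab q k n).subgroupOf H ≤ N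

/-- The defining vector `(1, -1, 0, …, 0)` of the growing Gupta-Sidki group. -/
def guptaSidkiVector (N : ℕ) : Fin N → ℤ :=
  fun i => if i.val = 0 then 1 else if i.val = 1 then -1 else 0

end GrowingGGS

/-! Modulo the product of the groups G_{k+1}', an element f of G_k that fixes the first level is a
product of conjugates of b_k by powers of a_k, with integer exponents ρ(t); these are also the
exponents of b_{k+1} in the sections of f (`HasCoordinates`). They are well defined because b_k has
infinite order modulo G_k', independently of a_k (`HasExponents.eq_zero_of_one`). This comes from a
p-adic descent through the levels that needs the growth of the degrees and the fact that zero
divisors in the group algebra of a finite abelian p-group over 𝔽_p have augmentation zero.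

Applied to iterated sections, the condition on second level stabilisers makes all ρ(t) divisible by
a prescribed p^R once f fixes a deep level. Dividing by p^R gives f = diag(h) y^{p^R} with all h(x)
in G_{k+1}', and with y in G_k' when f is in G_k' (`exists_pow_mul_diag`).

A normal subgroup N of index p^j contains all p^j-th powers and a term of the lower central series.
For k ≥ 1 the trivial sections that pad b_k give γ₃(G_k) ≥ G_{k+1}' × ⋯ × G_{k+1}'. So each passage
from G_k' to the sections h(x) gains one step of the lower central series, up to p^j-th powers of
elements of the derived subgroup (`exists_derived_inf_levelStab_le`). Finitely many such passages
put a deep element of G_0 in N; the passage from G_0 to G_1 needs only the derived condition. -/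

namespace GrowingGGS

/-! ### Tuples of sections and rooted automorphisms. -/

section Sections

variable {q : ℕ → ℕ} {k : ℕ}

/-- The inverse of `psi1`, as an embedding of `Aut T_{k+1} × ⋯ × Aut T_{k+1}` in `Aut T_k`. -/
def diag (q : ℕ → ℕ) (k : ℕ) : (Fin (q k) → AutT q (k + 1)) →* AutT q k :=
  (levelStab q k 1).subtype.comp (psi1 q k).symm.toMonoidHom

theorem diag_mem (h : Fin (q k) → AutT q (k + 1)) : diag q k h ∈ levelStab q k 1 :=
  ((psi1 q k).symm h).2

theorem diag_psi1 (f : levelStab q k 1) : diag q k (psi1 q k f) = f :=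
  congrArg Subtype.val ((psi1 q k).symm_apply_apply f)

theorem psi1_diag (h : Fin (q k) → AutT q (k + 1)) :
    psi1 q k ⟨diag q k h, diag_mem h⟩ = h := (psi1 q k).apply_symm_apply h

theorem exists_diag {f : AutT q k} (hf : f ∈ levelStab q k 1) : ∃ h, f = diag q k h :=
  ⟨psi1 q k ⟨f, hf⟩, (diag_psi1 ⟨f, hf⟩).symm⟩

theorem diag_injective : Function.Injective (diag q k) :=
  Subtype.val_injective.comp (psi1 q k).symm.injective

theorem diag_mem_levelStab {h : Fin (q k) → AutT q (k + 1)} {n : ℕ} :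
    diag q k h ∈ levelStab q k (n + 1) ↔ ∀ x, h x ∈ levelStab q (k + 1) n := by
  constructor
  · intro H x v
    exact congrArg Prod.snd (H (x, v))
  · rintro H ⟨x, v⟩
    exact Prod.ext rfl (H x v)

theorem parent_surjective [hq : ∀ k, NeZero (q k)] (n k : ℕ) :
    Function.Surjective (Word.parent (q := q) (k := k) (n := n)) := by
  induction n generalizing k with
  | zero => exact fun _ => ⟨((0 : Fin (q k)), ()), rfl⟩
  | succ n ih =>
    rintro ⟨x, v⟩
    obtain ⟨w, hw⟩ := ih (k + 1) v
    exact ⟨(x, w), Prod.ext rfl hw⟩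

theorem levelStab_antitone [hq : ∀ k, NeZero (q k)] (k : ℕ) : Antitone (levelStab q k) := by
  refine antitone_nat_of_succ_le fun n f hf v => ?_
  obtain ⟨w, rfl⟩ := parent_surjective n k v
  rw [← f.2 n w, hf w]

theorem exists_diag_of_mem_levelStab [hq : ∀ k, NeZero (q k)] {n : ℕ} {f : AutT q k}
    (hf : f ∈ levelStab q k (n + 1)) :
    ∃ h, f = diag q k h ∧ ∀ x, h x ∈ levelStab q (k + 1) n := by
  obtain ⟨h, rfl⟩ := exists_diag (levelStab_antitone k (Nat.le_add_left 1 n) hf)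
  exact ⟨h, rfl, diag_mem_levelStab.1 hf⟩

theorem ofSections_mul_diag (σ : Equiv.Perm (Fin (q k))) (h : Fin (q k) → AutT q (k + 1)) :
    ofSections σ (fun _ => 1) * diag q k h = ofSections σ h := by
  apply Subtype.ext
  funext n
  match n with
  | 0 => rfl
  | n + 1 => exact Equiv.ext fun w => rfl

theorem diag_mul_ofSections (σ : Equiv.Perm (Fin (q k))) (h : Fin (q k) → AutT q (k + 1)) :
    diag q k h * ofSections σ (fun _ => 1) = ofSections σ (fun x => h (σ x)) := by
  apply Subtype.ext
  funext n
  match n with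
  | 0 => rfl
  | n + 1 => exact Equiv.ext fun w => rfl

/-- The rooted automorphisms. -/
def rooted (q : ℕ → ℕ) (k : ℕ) : Equiv.Perm (Fin (q k)) →* AutT q k where
  toFun σ := ofSections σ fun _ => 1
  map_one' := by
    apply Subtype.ext
    funext n
    match n with
    | 0 => rfl
    | n + 1 => exact Equiv.ext fun w => rfl
  map_mul' σ τ := by
    apply Subtype.ext
    funext n
    match n with
    | 0 => rfl
    | n + 1 => exact Equiv.ext fun w => rfl

theorem a_eq_rooted : a q k = rooted q k (finRotate (q k)) := rfl

/-- The alphabet is treated as the cyclic group ℤ/n: the cycle is translation by 1, and the last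
letter is -1. -/
theorem finRotate_zpow_apply {n : ℕ} [NeZero n] (s : ℤ) (x : Fin n) :
    (finRotate n ^ s) x = x + s • (1 : Fin n) := by
  induction s with
  | zero => simp
  | succ i ih =>
    rw [add_comm, zpow_add, zpow_one, Equiv.Perm.mul_apply, ih, finRotate_apply, add_zsmul,
      one_zsmul]
    abel
  | pred i ih =>
    rw [sub_eq_neg_add, zpow_add, zpow_neg_one, Equiv.Perm.mul_apply, ih, Equiv.Perm.inv_def,
      finRotate_symm_apply, add_zsmul, neg_one_zsmul]
    abel

variable [hq : ∀ k, NeZero (q k)]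

theorem a_zpow_mul_diag (s : ℤ) (h : Fin (q k) → AutT q (k + 1)) :
    a q k ^ s * diag q k h = diag q k (fun x => h (x - s • 1)) * a q k ^ s := by
  rw [a_eq_rooted, ← map_zpow]
  change ofSections _ _ * _ = _ * ofSections _ _
  rw [ofSections_mul_diag, diag_mul_ofSections]
  congr 1
  funext x
  rw [finRotate_zpow_apply, add_sub_cancel_right]

theorem val_nsmul_one {n : ℕ} [NeZero n] (i : ℕ) : (i • (1 : Fin n)).val = i % n := by
  induction i with
  | zero => simp
  | succ i ih => rw [succ_nsmul, Fin.val_add, ih, Fin.val_one']; simp [Nat.add_mod]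

theorem exists_zsmul_one {n : ℕ} [NeZero n] (c : Fin n) : ∃ s : ℤ, s • (1 : Fin n) = c := by
  refine ⟨c.val, Fin.ext ?_⟩
  rw [natCast_zsmul, val_nsmul_one, Nat.mod_eq_of_lt c.2]

theorem zsmul_one_fin {n : ℕ} [NeZero n] {s : ℤ} : s • (1 : Fin n) = 0 ↔ (n : ℤ) ∣ s := by
  obtain ⟨i, rfl | rfl⟩ := s.eq_nat_or_neg
  all_goals
    try rw [neg_zsmul, neg_eq_zero, dvd_neg]
    rw [natCast_zsmul, ← Fin.val_eq_zero_iff, val_nsmul_one, Int.natCast_dvd_natCast,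
      Nat.dvd_iff_mod_eq_zero]

theorem a_zpow_eq_one {s : ℤ} : a q k ^ s = 1 ↔ (q k : ℤ) ∣ s := by
  rw [a_eq_rooted, ← map_zpow, ← zsmul_one_fin]
  constructor
  · intro h
    have := congrArg (fun f : AutT q k => (f.1 1 ((0 : Fin (q k)), ())).1) h
    change (finRotate (q k) ^ s) 0 = 0 at this
    rwa [finRotate_zpow_apply, zero_add] at this
  · intro h
    have : finRotate (q k) ^ s = 1 := by
      ext x
      rw [finRotate_zpow_apply, h, add_zero, Equiv.Perm.one_apply]
    rw [this, map_one]

theorem diag_mul_a_zpow_mem {s : ℤ} {h : Fin (q k) → AutT q (k + 1)} :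
    diag q k h * a q k ^ s ∈ levelStab q k 1 ↔ (q k : ℤ) ∣ s := by
  rw [Subgroup.mul_mem_cancel_left _ (diag_mem h), ← a_zpow_eq_one]
  refine ⟨fun h => ?_, fun h => h ▸ one_mem _⟩
  rw [a_eq_rooted, ← map_zpow] at h ⊢
  have : finRotate (q k) ^ s = 1 := by
    ext x
    exact congrArg (fun y : Word q k 1 => (y.1 : ℕ)) (h (x, ()))
  rw [this, map_one]

end Sections

/-! ### Exponents modulo the derived subgroup and coordinates of sections. -/

section Exponents

variable {q : ℕ → ℕ} {e : Fin (q 0 - 1) → ℤ} {k : ℕ}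

theorem a_mem : a q k ∈ G q e k := Subgroup.subset_closure (Or.inl rfl)

theorem b_mem : b q e k ∈ G q e k := Subgroup.subset_closure (Or.inr rfl)

/-- `g ∈ G_k` is congruent to `b_k ^ r * a_k ^ s` modulo the derived subgroup. -/
def HasExponents (q : ℕ → ℕ) (e : Fin (q 0 - 1) → ℤ) (k : ℕ) (g : AutT q k) (r s : ℤ) : Prop :=
  ∃ hg : g ∈ G q e k, Abelianization.of (⟨g, hg⟩ : G q e k) =
    Abelianization.of (⟨b q e k, b_mem⟩ : G q e k) ^ r *
      Abelianization.of (⟨a q k, a_mem⟩ : G q e k) ^ s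

namespace HasExponents

variable {g g' : AutT q k} {r r' s s' : ℤ}

theorem mem (h : HasExponents q e k g r s) : g ∈ G q e k := h.1

theorem one : HasExponents q e k 1 0 0 :=
  ⟨one_mem _, by simp [show (⟨1, one_mem _⟩ : G q e k) = 1 from rfl]⟩

theorem a_zpow (s : ℤ) : HasExponents q e k (a q k ^ s) 0 s :=
  ⟨zpow_mem a_mem s, by
    rw [zpow_zero, one_mul, ← map_zpow]
    rfl⟩

theorem b_zpow (r : ℤ) : HasExponents q e k (b q e k ^ r) r 0 :=
  ⟨zpow_mem b_mem r, by
    rw [zpow_zero, mul_one, ← map_zpow]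
    rfl⟩

theorem mul (h : HasExponents q e k g r s) (h' : HasExponents q e k g' r' s') :
    HasExponents q e k (g * g') (r + r') (s + s') := by
  obtain ⟨hg, h⟩ := h
  obtain ⟨hg', h'⟩ := h'
  refine ⟨mul_mem hg hg', ?_⟩
  rw [zpow_add, zpow_add, mul_mul_mul_comm, ← h, ← h', ← map_mul]
  rfl

theorem inv (h : HasExponents q e k g r s) : HasExponents q e k g⁻¹ (-r) (-s) := by
  obtain ⟨hg, h⟩ := h
  refine ⟨inv_mem hg, ?_⟩
  rw [zpow_neg, zpow_neg, ← mul_inv, ← h, ← map_inv]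
  rfl

theorem zpow (h : HasExponents q e k g r s) (n : ℤ) :
    HasExponents q e k (g ^ n) (r * n) (s * n) := by
  obtain ⟨hg, h⟩ := h
  refine ⟨zpow_mem hg n, ?_⟩
  rw [zpow_mul, zpow_mul, ← mul_zpow, ← h, ← map_zpow]
  rfl

theorem congr (h : HasExponents q e k g r s) (hg : g = g') (hr : r = r') (hs : s = s') :
    HasExponents q e k g' r' s' := hg ▸ hr ▸ hs ▸ h

theorem one_of_eq {g : AutT q k} {r r' s s' : ℤ} (h : HasExponents q e k g r s)
    (h' : HasExponents q e k g r' s') : HasExponents q e k 1 (r - r') (s - s') :=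
  (h.mul h'.inv).congr (mul_inv_cancel g) (by ring) (by ring)

end HasExponents

theorem mem_derived_iff {g : AutT q k} : g ∈ ⁅G q e k, G q e k⁆ ↔ HasExponents q e k g 0 0 := by
  rw [← Subgroup.map_subtype_commutator]
  simp only [HasExponents, zpow_zero, one_mul]
  constructor
  · rintro ⟨x, hx, rfl⟩
    refine ⟨x.2, ?_⟩
    rw [← MonoidHom.mem_ker, Abelianization.ker_of]
    exact hx
  · rintro ⟨hg, h⟩
    rw [← MonoidHom.mem_ker, Abelianization.ker_of] at h
    exact ⟨_, h, rfl⟩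

theorem HasExponents.mul_inv_mem {g g' : AutT q k} {r s : ℤ} (h : HasExponents q e k g r s)
    (h' : HasExponents q e k g' r s) : g * g'⁻¹ ∈ ⁅G q e k, G q e k⁆ :=
  mem_derived_iff.2 ((h.mul h'.inv).congr rfl (by ring) (by ring))

theorem derived_le : ⁅G q e k, G q e k⁆ ≤ G q e k := Subgroup.commutator_le_self _

/-- The exponent of `a_{k+1}` in the section of `b_k` at `x`. -/
def entry (q : ℕ → ℕ) (e : Fin (q 0 - 1) → ℤ) (k : ℕ) (x : Fin (q k)) : ℤ :=
  if x.val + 1 = q k then 0 else if h : x.val < q 0 - 1 then e ⟨x.val, h⟩ else 0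

/-- The tuple of sections of `b_k`. -/
def bSec (q : ℕ → ℕ) (e : Fin (q 0 - 1) → ℤ) (k : ℕ) (x : Fin (q k)) : AutT q (k + 1) :=
  if x.val + 1 = q k then b q e (k + 1) else a q (k + 1) ^ entry q e k x

theorem b_eq_diag : b q e k = diag q k (bSec q e k) := by
  refine (diag_psi1 ⟨b q e k, b_mem_levelStab q e k⟩).symm.trans (congrArg _ ?_)
  funext x
  rw [psi1_b, bSec, entry]
  split_ifs <;> simp

theorem val_add_one_eq_iff {n : ℕ} [NeZero n] {x : Fin n} : x.val + 1 = n ↔ x + 1 = 0 := by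
  have hx := x.2
  rw [Fin.ext_iff, Fin.val_add, Fin.val_one', Nat.add_mod_mod, Fin.val_zero]
  constructor
  · intro h
    rw [h, Nat.mod_self]
  · intro h
    exact Nat.le_antisymm hx (Nat.le_of_dvd (Nat.succ_pos _) (Nat.dvd_of_mod_eq_zero h))

/-- The exponent of `a_{k+1}` in the section at `x` of a product of conjugates `b_k ^ (a_k ^ (-t))`
with exponents `ρ t`. -/
def conv (q : ℕ → ℕ) (e : Fin (q 0 - 1) → ℤ) (k : ℕ) (ρ : Fin (q k) → ℤ) (x : Fin (q k)) : ℤ :=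
  ∑ t, ρ t * entry q e k (x - t)

theorem conv_add (ρ σ : Fin (q k) → ℤ) (x : Fin (q k)) :
    conv q e k (fun t => ρ t + σ t) x = conv q e k ρ x + conv q e k σ x := by
  simp only [conv, add_mul, Finset.sum_add_distrib]

theorem conv_neg (ρ : Fin (q k) → ℤ) (x : Fin (q k)) :
    conv q e k (fun t => -ρ t) x = -conv q e k ρ x := by
  simp only [conv, neg_mul, Finset.sum_neg_distrib]

variable [hq : ∀ k, NeZero (q k)]

theorem bSec_of_add_one {x : Fin (q k)} (hx : x + 1 = 0) : bSec q e k x = b q e (k + 1) :=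
  if_pos (val_add_one_eq_iff.2 hx)

theorem bSec_of_add_one_ne {x : Fin (q k)} (hx : x + 1 ≠ 0) :
    bSec q e k x = a q (k + 1) ^ entry q e k x := if_neg fun h => hx (val_add_one_eq_iff.1 h)

theorem entry_of_add_one {x : Fin (q k)} (hx : x + 1 = 0) : entry q e k x = 0 :=
  if_pos (val_add_one_eq_iff.2 hx)

theorem hasExponents_bSec (x : Fin (q k)) : HasExponents q e (k + 1) (bSec q e k x)
    ((Pi.single 0 1 : Fin (q k) → ℤ) (x + 1)) (entry q e k x) := by
  by_cases hx : x + 1 = 0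
  · rw [bSec_of_add_one hx, hx, entry_of_add_one hx, Pi.single_eq_same]
    simpa using HasExponents.b_zpow (q := q) (e := e) (k := k + 1) 1
  · rw [bSec_of_add_one_ne hx, Pi.single_eq_of_ne hx]
    exact .a_zpow _

theorem conv_shift (ρ : Fin (q k) → ℤ) (c x : Fin (q k)) :
    conv q e k (fun t => ρ (t - c)) x = conv q e k ρ (x - c) := by
  unfold conv
  refine (Equiv.sum_comp (Equiv.addRight c) _).symm.trans (Finset.sum_congr rfl fun t _ => ?_)
  simp only [Equiv.coe_addRight, add_sub_cancel_right]
  congr 2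
  abel

theorem conv_single (r : ℤ) (x : Fin (q k)) :
    conv q e k (Pi.single 0 r) x = r * entry q e k x := by
  unfold conv
  rw [Finset.sum_eq_single 0]
  · simp
  · intro t _ ht
    rw [Pi.single_eq_of_ne ht, zero_mul]
  · simp

theorem sum_shift (ρ : Fin (q k) → ℤ) (c : Fin (q k)) : ∑ t, ρ (t - c) = ∑ t, ρ t :=
  Equiv.sum_comp (Equiv.subRight c) ρ

/-- `g ∈ G_k` is, modulo the product of the groups `G_{k+1}'`, the product of `a_k ^ s` and of
conjugates `b_k ^ (a_k ^ (-t))` with exponents `ρ t`. -/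
def HasCoordinates (q : ℕ → ℕ) (e : Fin (q 0 - 1) → ℤ) [∀ k, NeZero (q k)] (k : ℕ) (g : AutT q k)
    (ρ : Fin (q k) → ℤ) (s : ℤ) : Prop :=
  HasExponents q e k g (∑ t, ρ t) s ∧ ∃ h, g = diag q k h * a q k ^ s ∧
    ∀ x, HasExponents q e (k + 1) (h x) (ρ (x + 1)) (conv q e k ρ x)

namespace HasCoordinates

variable {g g' : AutT q k} {ρ ρ' : Fin (q k) → ℤ} {s s' : ℤ}

theorem one : HasCoordinates q e k 1 (fun _ => 0) 0 := by
  refine ⟨by simpa using HasExponents.one, 1, by simp, fun x => ?_⟩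
  simpa [conv] using HasExponents.one

theorem a_zpow (s : ℤ) : HasCoordinates q e k (a q k ^ s) (fun _ => 0) s := by
  refine ⟨by simpa using HasExponents.a_zpow s, 1, by simp, fun x => ?_⟩
  simpa [conv] using HasExponents.one

theorem b : HasCoordinates q e k (b q e k) (Pi.single 0 1) 0 := by
  refine ⟨by simpa using HasExponents.b_zpow (q := q) (e := e) (k := k) 1, bSec q e k,
    by rw [zpow_zero, mul_one, b_eq_diag], fun x => ?_⟩
  rw [conv_single, one_mul]
  exact hasExponents_bSec x

/-- Moving `a q k ^ s` past the second factor translates the coordinates of that factor by s. -/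
theorem mul (h : HasCoordinates q e k g ρ s) (h' : HasCoordinates q e k g' ρ' s') :
    HasCoordinates q e k (g * g') (fun t => ρ t + ρ' (t - s • 1)) (s + s') := by
  obtain ⟨h1, h, rfl, hx⟩ := h
  obtain ⟨h1', h', rfl, hx'⟩ := h'
  refine ⟨?_, fun x => h x * h' (x - s • 1), ?_, fun x => ?_⟩
  · rw [Finset.sum_add_distrib, sum_shift]
    exact h1.mul h1'
  · rw [mul_assoc, ← mul_assoc (_ ^ s), a_zpow_mul_diag, zpow_add]
    change _ = diag q k (h * fun x => h' (x - s • 1)) * _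
    rw [map_mul]
    group
  · rw [conv_add, conv_shift]
    refine ((hx x).mul (hx' (x - s • 1))).congr rfl ?_ rfl
    rw [sub_add_eq_add_sub]

theorem inv (h : HasCoordinates q e k g ρ s) :
    HasCoordinates q e k g⁻¹ (fun t => -ρ (t + s • 1)) (-s) := by
  obtain ⟨h1, h, rfl, hx⟩ := h
  have key : ∀ t : Fin (q k), t + s • 1 = t - (-s) • 1 := fun t => by
    rw [neg_zsmul, sub_neg_eq_add]
  refine ⟨?_, fun x => (h (x + s • 1))⁻¹, ?_, fun x => ?_⟩
  · simp only [key]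
    rw [Finset.sum_neg_distrib, sum_shift]
    exact h1.inv
  · rw [mul_inv_rev, ← zpow_neg, ← map_inv, a_zpow_mul_diag]
    simp only [key]
    rfl
  · simp only [key]
    rw [conv_neg, conv_shift]
    refine (hx _).inv.congr rfl ?_ rfl
    rw [sub_add_eq_add_sub]

theorem congr (h : HasCoordinates q e k g ρ s) (hg : g = g') (hr : ∀ t, ρ t = ρ' t)
    (hs : s = s') : HasCoordinates q e k g' ρ' s' := hg ▸ (funext hr : ρ = ρ') ▸ hs ▸ h

theorem mem (h : HasCoordinates q e k g ρ s) : g ∈ G q e k := h.1.mem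

end HasCoordinates

theorem exists_hasCoordinates {g : AutT q k} (hg : g ∈ G q e k) :
    ∃ ρ s, HasCoordinates q e k g ρ s := by
  induction hg using Subgroup.closure_induction with
  | mem x hx =>
    rcases hx with rfl | rfl
    · exact ⟨_, 1, (HasCoordinates.a_zpow 1).congr (zpow_one _) (fun _ => rfl) rfl⟩
    · exact ⟨_, _, .b⟩
  | one => exact ⟨_, _, .one⟩
  | mul x y _ _ hx hy =>
    obtain ⟨ρ, s, h⟩ := hx
    obtain ⟨ρ', s', h'⟩ := hy
    exact ⟨_, _, h.mul h'⟩
  | inv x _ hx =>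
    obtain ⟨ρ, s, h⟩ := hx
    exact ⟨_, _, h.inv⟩

/-- Exponents are not yet known to be unique, so the coordinates with sum exactly 0 are produced
directly: each factor of a commutator occurs with its inverse, and translation does not change sums.
-/
theorem exists_hasCoordinates_of_mem_derived {g : AutT q k} (hg : g ∈ ⁅G q e k, G q e k⁆) :
    ∃ ρ, HasCoordinates q e k g ρ 0 ∧ ∑ t, ρ t = 0 := by
  let H : Subgroup (AutT q k) :=
    { carrier := {g | ∃ ρ, HasCoordinates q e k g ρ 0 ∧ ∑ t, ρ t = 0}
      one_mem' := ⟨_, .one, by simp⟩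
      mul_mem' := by
        rintro x y ⟨ρ, h, hs⟩ ⟨ρ', h', hs'⟩
        refine ⟨fun t => ρ t + ρ' t, (h.mul h').congr rfl (fun t => by simp) (by simp), ?_⟩
        rw [Finset.sum_add_distrib, hs, hs', add_zero]
      inv_mem' := by
        rintro x ⟨ρ, h, hs⟩
        refine ⟨fun t => -ρ t, h.inv.congr rfl (fun t => by simp) (by simp), ?_⟩
        rw [Finset.sum_neg_distrib, hs, neg_zero] }
  refine (Subgroup.commutator_le.2 ?_ : _ ≤ H) hg
  intro x hx y hy
  obtain ⟨ρ, s, h⟩ := exists_hasCoordinates hx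
  obtain ⟨ρ', s', h'⟩ := exists_hasCoordinates hy
  have H := ((h.mul h').mul h.inv).mul h'.inv
  refine ⟨_, H.congr rfl (fun _ => rfl) (by ring), ?_⟩
  have key : ∀ (σ : Fin (q k) → ℤ) (c d : Fin (q k)), ∑ t, -σ (t - c + d) = -∑ t, σ t := by
    intro σ c d
    rw [Finset.sum_neg_distrib]
    simp only [sub_add, sum_shift]
  rw [Finset.sum_add_distrib, Finset.sum_add_distrib, Finset.sum_add_distrib, key, key, sum_shift]
  ring

end Exponents

/-! ### The group algebra lemma and the independence of b_k modulo G_k'. -/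

/-- In the group algebra of a finite abelian `p`-group over `𝔽_p` the zero divisors have
augmentation zero. -/
theorem sum_eq_zero_of_convolution_eq_zero {p n : ℕ} [Fact p.Prime] {Γ : Type*} [AddCommGroup Γ]
    [Fintype Γ] (hΓ : Fintype.card Γ = p ^ n) {ρ f : Γ → ZMod p}
    (h : ∀ x, ∑ t, ρ t * f (x - t) = 0) {j : Γ} (hj : f j ≠ 0) : ∑ t, ρ t = 0 := by
  classical
  let S : AddMonoidAlgebra (ZMod p) Γ := ∑ t, AddMonoidAlgebra.single t (ρ t)
  let E : AddMonoidAlgebra (ZMod p) Γ := ∑ t, AddMonoidAlgebra.single t (f t)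
  have hSE : S * E = 0 := by
    have : S * E = ∑ x, AddMonoidAlgebra.single x (∑ t, ρ t * f (x - t)) := by
      simp only [S, E, Finset.sum_mul_sum, AddMonoidAlgebra.single_mul_single]
      simp only [← AddMonoidAlgebra.singleAddHom_apply, map_sum]
      rw [Finset.sum_comm (f := fun x t => AddMonoidAlgebra.singleAddHom x (ρ t * f (x - t)))]
      refine Finset.sum_congr rfl fun t _ => ?_
      symm
      rw [← Equiv.sum_comp (Equiv.addLeft t)]
      simp
    rw [this]
    simp [h]
  have : CharP (AddMonoidAlgebra (ZMod p) Γ) p :=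
    charP_of_injective_algebraMap' (ZMod p) p
  -- Frobenius: the p^n-th power sends every element of Γ to the identity and fixes coefficients in
  -- 𝔽_p, so S becomes its augmentation, a scalar.
  have hS : S ^ p ^ n = AddMonoidAlgebra.single 0 (∑ t, ρ t) := by
    simp only [S]
    rw [sum_pow_char_pow, ← AddMonoidAlgebra.singleAddHom_apply, map_sum]
    refine Finset.sum_congr rfl fun t _ => ?_
    rw [AddMonoidAlgebra.single_pow, ZMod.pow_card_pow, ← hΓ, card_nsmul_eq_zero]
    rfl
  have h0 : S ^ p ^ n * E = 0 := by
    obtain ⟨i, hi⟩ := Nat.exists_eq_succ_of_ne_zero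
      (pow_ne_zero n (Fact.out : p.Prime).ne_zero)
    rw [hi, pow_succ, mul_assoc, hSE, mul_zero]
  rw [hS] at h0
  have h1 : (∑ t, ρ t) * f j = 0 := by
    have h1 := congrArg (fun u : AddMonoidAlgebra (ZMod p) Γ => u.coeff j) h0
    simpa [E, Finset.mul_sum, AddMonoidAlgebra.single_mul_single, Finsupp.single_apply] using h1
  exact (mul_eq_zero.1 h1).resolve_right hj

section Independence

variable {p : ℕ} [hp : Fact p.Prime] {m : ℕ → ℕ} {q : ℕ → ℕ} {e : Fin (q 0 - 1) → ℤ} {k : ℕ}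
  [hq : ∀ k, NeZero (q k)]

theorem pow_dvd_sum_of_dvd_conv (hqm : q k = p ^ m k) {ρ : Fin (q k) → ℤ} {n : ℕ}
    (hρ : ∀ t, (p : ℤ) ^ n ∣ ρ t) (hc : ∀ x, (p : ℤ) ^ (n + 1) ∣ conv q e k ρ x)
    (he : ∃ x, ¬ (p : ℤ) ∣ entry q e k x) : (p : ℤ) ^ (n + 1) ∣ ∑ t, ρ t := by
  choose σ hσ using hρ
  obtain rfl : ρ = fun t => p ^ n * σ t := funext hσ
  obtain ⟨j, hj⟩ := he
  have hp0 : (p : ℤ) ^ n ≠ 0 := pow_ne_zero _ (mod_cast hp.1.ne_zero)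
  simp only [conv, mul_assoc, ← Finset.mul_sum, pow_succ] at hc ⊢
  refine mul_dvd_mul_left _ ?_
  have := sum_eq_zero_of_convolution_eq_zero (p := p) (n := m k) (Γ := Fin (q k))
    (ρ := fun t => (σ t : ZMod p)) (f := fun x => (entry q e k x : ZMod p)) (j := j)
    ((Fintype.card_fin _).trans hqm) (fun x => ?_) (fun h => hj ?_)
  · rw [← ZMod.intCast_zmod_eq_zero_iff_dvd]
    simpa using this
  · have := Int.dvd_of_mul_dvd_mul_left hp0 (hc x)
    rw [← ZMod.intCast_zmod_eq_zero_iff_dvd] at this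
    simpa using this
  · exact (ZMod.intCast_zmod_eq_zero_iff_dvd _ _).1 h

theorem derived_le_levelStab : ⁅G q e k, G q e k⁆ ≤ levelStab q k 1 := by
  intro g hg
  obtain ⟨ρ, ⟨-, h, rfl, -⟩, -⟩ := exists_hasCoordinates_of_mem_derived hg
  exact diag_mul_a_zpow_mem.2 (dvd_zero _)

theorem dvd_of_mem_levelStab {g : AutT q k} {r s : ℤ} (h : HasExponents q e k g r s)
    (hg : g ∈ levelStab q k 1) : (q k : ℤ) ∣ s := by
  have hb : b q e k ^ r ∈ levelStab q k 1 := zpow_mem (b_mem_levelStab q e k) r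
  have H := derived_le_levelStab (h.mul_inv_mem
    (((HasExponents.b_zpow r).mul (HasExponents.a_zpow s)).congr rfl (add_zero r) (zero_add s)))
  rw [Subgroup.mul_mem_cancel_left _ hg, inv_mem_iff, Subgroup.mul_mem_cancel_left _ hb] at H
  refine (diag_mul_a_zpow_mem (h := 1)).1 ?_
  rwa [map_one, one_mul]

/-- The exponent of `a q k` matters only modulo its order q_k. -/
theorem HasExponents.drop_a {g : AutT q k} {r s : ℤ} (h : HasExponents q e k g r s)
    (hs : (q k : ℤ) ∣ s) : HasExponents q e k g r 0 :=
  (h.mul (HasExponents.a_zpow (-s))).congr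
    (by rw [a_zpow_eq_one.2 ((dvd_neg (α := ℤ)).2 hs), mul_one]) (add_zero r) (by ring)

/-- A power of `b_k` that is trivial modulo `G_k'` comes from a vector of powers of `b_{k+1}`
that are trivial modulo `G_{k+1}'`. -/
theorem HasExponents.exists_of_one {r s : ℤ} (h : HasExponents q e k 1 r s) :
    ∃ ρ : Fin (q k) → ℤ, ∑ t, ρ t = r ∧ (∀ t, HasExponents q e (k + 1) 1 (ρ t) 0) ∧
      ∀ x, (q (k + 1) : ℤ) ∣ conv q e k ρ x := by
  have hs := dvd_of_mem_levelStab h (one_mem _)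
  have hb := mem_derived_iff.2 (((h.drop_a hs).inv.mul (HasExponents.b_zpow r)).congr
    (g' := b q e k ^ r) (by simp) (by simp) (by simp))
  obtain ⟨ρ, ⟨-, f, hf, hx⟩, hρ⟩ := exists_hasCoordinates_of_mem_derived hb
  rw [zpow_zero, mul_one, b_eq_diag, ← map_zpow] at hf
  obtain rfl := diag_injective hf
  -- The sections of b_k^r have exponents read off from b_k itself, and others that come from its
  -- membership in G_k'. Their differences are relations in the abelianization of G_{k+1}.
  have H : ∀ x, HasExponents q e (k + 1) 1 ((Pi.single 0 r : Fin (q k) → ℤ) (x + 1) - ρ (x + 1))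
      (conv q e k (Pi.single 0 r) x - conv q e k ρ x) := by
    intro x
    refine HasExponents.one_of_eq (g := (bSec q e k ^ r) x) ?_ (hx x)
    have := (hasExponents_bSec (q := q) (e := e) x).zpow r
    rw [conv_single]
    refine this.congr rfl ?_ (mul_comm _ _)
    rw [Pi.single_apply, Pi.single_apply]
    split_ifs <;> simp
  have H' : ∀ x, (q (k + 1) : ℤ) ∣ conv q e k (Pi.single 0 r) x - conv q e k ρ x :=
    fun x => dvd_of_mem_levelStab (H x) (one_mem _)
  refine ⟨fun t => (Pi.single 0 r : Fin (q k) → ℤ) t + -ρ t, ?_, fun t => ?_, fun x => ?_⟩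
  · rw [Finset.sum_add_distrib, Finset.sum_neg_distrib, hρ]
    simp
  · simpa [sub_eq_add_neg] using (H (t - 1)).drop_a (H' _)
  · rw [conv_add, conv_neg, ← sub_eq_add_neg]
    exact H' x

theorem HasExponents.one_succ {r s : ℤ} (h : HasExponents q e k 1 r s) :
    HasExponents q e (k + 1) 1 r 0 := by
  obtain ⟨ρ, rfl, hρ, -⟩ := h.exists_of_one
  refine Finset.sum_induction ρ (fun r => HasExponents q e (k + 1) 1 r 0) (fun r r' h h' => ?_)
    .one fun t _ => hρ t
  exact (h.mul h').congr (one_mul 1) rfl (add_zero 0)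

/-- The degrees are powers of `p` with increasing exponents, and some entry of the vector is prime
to `p`. -/
structure Admissible (p : ℕ) (m q : ℕ → ℕ) (e : Fin (q 0 - 1) → ℤ) : Prop where
  card : ∀ k, q k = p ^ m k
  mono : StrictMono m
  unit : ∀ k, ∃ x, ¬ (p : ℤ) ∣ entry q e k x

/-- Modulo `G_k'` the element `b_k` has infinite order and is independent of `a_k`. -/
theorem HasExponents.eq_zero_of_one (H : Admissible p m q e) {r s : ℤ} (h : HasExponents q e k 1 r s) :
    r = 0 := by
  have key : ∀ n k r s, HasExponents q e k 1 r s → (p : ℤ) ^ n ∣ r := by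
    intro n
    induction n with
    | zero => simp
    | succ n ih =>
      -- At depth k ≥ n the degree q_{k+1} is divisible by p^(n+1), so the convolution vanishes
      -- modulo p^(n+1) and one more factor p is gained.
      have large : ∀ k r s, n ≤ k → HasExponents q e k 1 r s → (p : ℤ) ^ (n + 1) ∣ r := by
        intro k r s hk h
        obtain ⟨ρ, rfl, hρ, hc⟩ := h.exists_of_one
        refine pow_dvd_sum_of_dvd_conv (H.card k) (fun t => ih _ _ _ (hρ t)) (fun x => ?_) (H.unit k)
        refine dvd_trans ?_ (hc x)
        rw [H.card, Nat.cast_pow]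
        exact pow_dvd_pow _ (le_trans (by omega) (H.mono.le_apply (x := k + 1)))
      -- A relation at a shallow level persists with the same r at the next level, hence reaches
      -- depth n.
      have all : ∀ d k r s, n ≤ k + d → HasExponents q e k 1 r s → (p : ℤ) ^ (n + 1) ∣ r := by
        intro d
        induction d with
        | zero => exact large
        | succ d ihd => exact fun k r s hk h => ihd (k + 1) r 0 (by omega) h.one_succ
      exact fun k r s => all n k r s (by omega)
  by_contra hr
  obtain ⟨n, hn⟩ := Int.finiteMultiplicity_iff.2 ⟨by rw [Int.natAbs_natCast]; exact hp.1.ne_one, hr⟩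
  exact hn (key _ _ _ _ h)

end Independence

/-! ### Deep elements are proper powers modulo G_{k+1}' × ⋯ × G_{k+1}'. -/

section Congruence

variable {p : ℕ} [hp : Fact p.Prime] {m : ℕ → ℕ} {q : ℕ → ℕ} {e : Fin (q 0 - 1) → ℤ} {k : ℕ}
  [hq : ∀ k, NeZero (q k)]

/-- The conjugates of `b_k` by powers of `a_k`. -/
theorem hasExponents_diag_bSec_sub (c : Fin (q k)) :
    HasExponents q e k (diag q k (fun x => bSec q e k (x - c))) 1 0 := by
  obtain ⟨s, rfl⟩ := exists_zsmul_one c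
  have h := a_zpow_mul_diag s (bSec q e k)
  rw [← b_eq_diag] at h
  rw [← mul_inv_eq_iff_eq_mul.2 h]
  exact (((HasExponents.a_zpow s).mul (HasExponents.b_zpow 1)).mul
    (HasExponents.a_zpow s).inv).congr (by rw [zpow_one]) (by ring) (by ring)

theorem diag_bSec_sub_mem (c : Fin (q k)) :
    diag q k (fun x => bSec q e k (x - c)) ∈ G q e k := (hasExponents_diag_bSec_sub c).mem

/-- A subgroup of `Aut T_k` that contains `a_k ^ u`, with `u` prime to `p`, contains `a_k`. -/
theorem a_mem_of_zpow_mem (H : Admissible p m q e) {K : Subgroup (AutT q k)} {u : ℤ}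
    (hu : ¬ (p : ℤ) ∣ u) (ha : a q k ^ u ∈ K) : a q k ∈ K := by
  have : IsCoprime u (q k : ℤ) := by
    rw [H.card, Nat.cast_pow]
    exact (((Nat.prime_iff_prime_int.1 hp.1).coprime_iff_not_dvd.2 hu).pow_left).symm
  obtain ⟨c, d, h⟩ := this
  have h1 : a q k = (a q k ^ u) ^ c := by
    rw [← zpow_mul, eq_comm]
    calc a q k ^ (u * c) = a q k ^ (c * u + d * q k) := by
          rw [zpow_add, a_zpow_eq_one.2 (dvd_mul_left _ d), mul_one, mul_comm]
      _ = _ := by rw [h, zpow_one]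
  rw [h1]
  exact zpow_mem ha c

/-- Every element of `G_{k+1}` is the section at `x` of an element of `St_{G_k}(1)`. -/
theorem exists_section (H : Admissible p m q e) (x : Fin (q k)) {g : AutT q (k + 1)}
    (hg : g ∈ G q e (k + 1)) : ∃ h, diag q k h ∈ G q e k ∧ h x = g := by
  let K := ((G q e k).comap (diag q k)).map
    (Pi.evalMonoidHom (fun _ : Fin (q k) => AutT q (k + 1)) x)
  have hK : ∀ y, bSec q e k y ∈ K := fun y =>
    ⟨_, diag_bSec_sub_mem (x - y), congrArg (bSec q e k) (sub_sub_cancel x y)⟩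
  suffices G q e (k + 1) ≤ K from this hg
  refine (Subgroup.closure_le _).2 ?_
  rintro _ (rfl | rfl)
  · obtain ⟨j, hj⟩ := H.unit k
    refine a_mem_of_zpow_mem H hj ?_
    rw [← bSec_of_add_one_ne]
    · exact hK j
    · exact fun h => hj (by rw [entry_of_add_one h]; exact dvd_zero _)
  · rw [SetLike.mem_coe, ← bSec_of_add_one (neg_add_cancel (1 : Fin (q k)))]
    exact hK _

theorem HasCoordinates.eq_diag {f : AutT q k} {ρ : Fin (q k) → ℤ} {s : ℤ}
    (h : HasCoordinates q e k f ρ s) (hf : f ∈ levelStab q k 1) :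
    HasCoordinates q e k f ρ 0 := by
  obtain ⟨h1, g, rfl, hg⟩ := h
  have hs := diag_mul_a_zpow_mem.1 hf
  exact ⟨h1.drop_a hs, g, by rw [a_zpow_eq_one.2 hs, zpow_zero], hg⟩

theorem HasCoordinates.hasExponents {h : Fin (q k) → AutT q (k + 1)} {ρ : Fin (q k) → ℤ}
    (H : HasCoordinates q e k (diag q k h) ρ 0) (x : Fin (q k)) :
    HasExponents q e (k + 1) (h x) (ρ (x + 1)) (conv q e k ρ x) := by
  obtain ⟨-, h', heq, hx⟩ := H
  rw [zpow_zero, mul_one] at heq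
  rw [diag_injective heq]
  exact hx x

theorem exists_hasCoordinates_diag {h : Fin (q k) → AutT q (k + 1)}
    (hh : diag q k h ∈ G q e k) : ∃ ρ, HasCoordinates q e k (diag q k h) ρ 0 := by
  obtain ⟨ρ, s, H⟩ := exists_hasCoordinates hh
  exact ⟨ρ, H.eq_diag (diag_mem h)⟩

theorem section_mem {h : Fin (q k) → AutT q (k + 1)} (hh : diag q k h ∈ G q e k)
    (x : Fin (q k)) : h x ∈ G q e (k + 1) := by
  obtain ⟨ρ, H⟩ := exists_hasCoordinates_diag hh
  exact (H.hasExponents x).mem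

omit hq in
theorem mem_zpowers_b_sup_derived_iff {f : AutT q k} {d : ℕ} :
    f ∈ Subgroup.zpowers (b q e k ^ d) ⊔ ⁅G q e k, G q e k⁆ ↔
      ∃ r, HasExponents q e k f r 0 ∧ (d : ℤ) ∣ r := by
  constructor
  · let K : Subgroup (AutT q k) :=
      { carrier := {f | ∃ r, HasExponents q e k f r 0 ∧ (d : ℤ) ∣ r}
        one_mem' := ⟨0, .one, dvd_zero _⟩
        mul_mem' := by
          rintro x y ⟨r, h, hr⟩ ⟨s, h', hs⟩
          exact ⟨r + s, h.mul h', dvd_add hr hs⟩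
        inv_mem' := by
          rintro x ⟨r, h, hr⟩
          exact ⟨-r, h.inv, (dvd_neg (α := ℤ)).2 hr⟩ }
    intro hf
    refine (sup_le ?_ ?_ : _ ≤ K) hf
    · rw [Subgroup.zpowers_le]
      exact ⟨d, (HasExponents.b_zpow d).congr (zpow_natCast _ _) rfl rfl, dvd_rfl⟩
    · exact fun g hg => ⟨0, mem_derived_iff.1 hg, dvd_zero _⟩
  · rintro ⟨_, h, r, rfl⟩
    rw [← inv_mul_cancel_right f (b q e k ^ (d * r : ℤ)), ← inv_inv (b q e k ^ (d * r : ℤ))]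
    refine mul_mem (Subgroup.mem_sup_right ?_) (Subgroup.mem_sup_left ?_)
    · rw [inv_inv]
      exact h.mul_inv_mem (HasExponents.b_zpow _)
    · rw [inv_inv, zpow_mul, zpow_natCast]
      exact zpow_mem (Subgroup.mem_zpowers _) r

/-- The condition on second level stabilisers is applied n levels down. The exponent of b_k is the
sum of the exponents of b_{k+1} in the sections, and uniqueness of exponents carries the
divisibility upwards. -/
theorem exists_hasExponents_of_mem_levelStab (H : Admissible p m q e) (hS : StabCondition q e)
    (n k : ℕ) {f : AutT q k} (hf : f ∈ G q e k) (hfn : f ∈ levelStab q k (n + 2)) :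
    ∃ r, HasExponents q e k f r 0 ∧ (q (k + n) : ℤ) ∣ r := by
  induction n generalizing k with
  | zero =>
    exact mem_zpowers_b_sup_derived_iff.1 (hS k (Subgroup.mem_inf.2 ⟨hf, hfn⟩))
  | succ n ih =>
    obtain ⟨h, rfl, hh⟩ := exists_diag_of_mem_levelStab hfn
    obtain ⟨ρ, hρ⟩ := exists_hasCoordinates_diag hf
    refine ⟨_, hρ.1, Finset.dvd_sum fun t _ => ?_⟩
    have ht := hρ.hasExponents (t - 1)
    rw [sub_add_cancel] at ht
    obtain ⟨r, hr, hdvd⟩ := ih (k + 1) ht.mem (hh (t - 1))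
    rw [← sub_eq_zero.1 ((hr.one_of_eq ht).eq_zero_of_one H)]
    rwa [show k + (n + 1) = k + 1 + n by omega]

theorem exists_pow_dvd_of_mem_levelStab (H : Admissible p m q e) (hS : StabCondition q e)
    (R k : ℕ) : ∃ M, ∀ h, diag q k h ∈ G q e k → diag q k h ∈ levelStab q k M →
      ∃ ρ, HasCoordinates q e k (diag q k h) ρ 0 ∧ ∀ t, (p : ℤ) ^ R ∣ ρ t := by
  -- One level is lost on passing to sections, two more belong to the stabiliser condition; then
  -- q_{k+1+R} is divisible by p^R.
  refine ⟨R + 3, fun h hG hM => ?_⟩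
  obtain ⟨ρ, hρ⟩ := exists_hasCoordinates_diag hG
  refine ⟨ρ, hρ, fun t => ?_⟩
  have ht := hρ.hasExponents (t - 1)
  rw [sub_add_cancel] at ht
  obtain ⟨r, hr, hdvd⟩ := exists_hasExponents_of_mem_levelStab H hS R (k + 1) ht.mem
    (diag_mem_levelStab.1 hM (t - 1))
  rw [← sub_eq_zero.1 ((hr.one_of_eq ht).eq_zero_of_one H)]
  refine dvd_trans ?_ hdvd
  rw [H.card, Nat.cast_pow]
  exact pow_dvd_pow _ (le_trans (by omega) (H.mono.le_apply (x := k + 1 + R)))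

/-- The realisable coordinate vectors form an additive group, and the conjugates of b_k by powers of
a_k realise the unit vectors. -/
theorem exists_mem_hasCoordinates (ρ : Fin (q k) → ℤ) : ∃ y, HasCoordinates q e k y ρ 0 := by
  let K : AddSubgroup (Fin (q k) → ℤ) :=
    { carrier := {ρ | ∃ y, HasCoordinates q e k y ρ 0}
      zero_mem' := ⟨1, .one⟩
      add_mem' := by
        rintro _ _ ⟨y, h⟩ ⟨y', h'⟩
        exact ⟨y * y', (h.mul h').congr rfl (fun t => by simp) (add_zero 0)⟩
      neg_mem' := by
        rintro _ ⟨y, h⟩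
        exact ⟨y⁻¹, h.inv.congr rfl (fun t => by simp) neg_zero⟩ }
  have hK : ∀ t, Pi.single t 1 ∈ K := by
    intro t
    obtain ⟨s, hs⟩ := exists_zsmul_one t
    refine ⟨_, (((HasCoordinates.a_zpow s).mul .b).mul (HasCoordinates.a_zpow (-s))).congr rfl
      (fun x => ?_) (by ring)⟩
    simp only [hs, zero_add, add_zero, Pi.single_apply, sub_eq_zero]
  suffices ρ ∈ K from this
  rw [← Finset.univ_sum_single ρ]
  refine sum_mem fun t _ => ?_
  have : Pi.single t (ρ t) = ρ t • (Pi.single t 1 : Fin (q k) → ℤ) := by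
    rw [← Pi.single_smul, smul_eq_mul, mul_one]
  rw [this]
  exact zsmul_mem (hK t) _

theorem HasCoordinates.pow {y : AutT q k} {ρ : Fin (q k) → ℤ} (h : HasCoordinates q e k y ρ 0)
    (n : ℕ) : HasCoordinates q e k (y ^ n) (fun t => n * ρ t) 0 := by
  induction n with
  | zero => exact HasCoordinates.one.congr (pow_zero y).symm (fun t => by simp) rfl
  | succ n ih =>
    exact (ih.mul h).congr (pow_succ y n).symm (fun t => by simp [add_mul]) (add_zero 0)

theorem HasCoordinates.exists_pow {y : AutT q k} {ρ : Fin (q k) → ℤ} {s : ℤ}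
    (h : HasCoordinates q e k y ρ s) (n : ℕ) :
    ∃ σ, HasCoordinates q e k (y ^ n) σ ((n : ℤ) * s) := by
  induction n with
  | zero => exact ⟨_, HasCoordinates.one.congr (pow_zero y).symm (fun _ => rfl) (by simp)⟩
  | succ n ih =>
    obtain ⟨σ, hσ⟩ := ih
    exact ⟨_, (hσ.mul h).congr (pow_succ y n).symm (fun _ => rfl) (by push_cast; ring)⟩

/-- Elements of `G_k` that are deep in the congruence filtration are proper powers modulo
`G_{k+1}' × ⋯ × G_{k+1}'`. -/
theorem exists_pow_mul_diag (H : Admissible p m q e) (hS : StabCondition q e) (R k : ℕ) :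
    ∃ M, ∀ f ∈ G q e k, f ∈ levelStab q k M → ∃ y ∈ G q e k, ∃ h, f = diag q k h * y ^ p ^ R ∧
      (∀ x, h x ∈ ⁅G q e (k + 1), G q e (k + 1)⁆) ∧
      (f ∈ ⁅G q e k, G q e k⁆ → y ∈ ⁅G q e k, G q e k⁆) := by
  obtain ⟨M, hM⟩ := exists_pow_dvd_of_mem_levelStab H hS R k
  -- The extra 1 ensures that f fixes the first level, also when M = 0.
  refine ⟨M + 1, fun f hf hfM => ?_⟩
  obtain ⟨g, rfl⟩ := exists_diag (levelStab_antitone k (Nat.le_add_left 1 M) hfM)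
  obtain ⟨ρ, hρ, hdvd⟩ := hM g hf (levelStab_antitone k (Nat.le_succ M) hfM)
  choose σ hσ using hdvd
  obtain rfl : ρ = fun t => p ^ R * σ t := funext hσ
  obtain ⟨y, hy⟩ := exists_mem_hasCoordinates (q := q) (e := e) σ
  have hz : HasCoordinates q e k (diag q k g * (y ^ p ^ R)⁻¹) (fun _ => 0) 0 :=
    (hρ.mul (hy.pow (p ^ R)).inv).congr rfl (fun t => by simp) (by ring)
  have hz' := hz.2
  obtain ⟨h, hh, hx⟩ := hz'
  rw [zpow_zero, mul_one] at hh
  refine ⟨y, hy.mem, h, mul_inv_eq_iff_eq_mul.1 hh, fun x => mem_derived_iff.2 ?_, fun hd => ?_⟩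
  · exact (hx x).congr rfl rfl (by simp [conv])
  -- For f in G_k' the sum of p^R σ is 0 by uniqueness of exponents, hence so is the sum of σ, which
  -- is the exponent of y.
  · have h0 := (hρ.1.one_of_eq (mem_derived_iff.1 hd)).eq_zero_of_one H
    rw [sub_zero, ← Finset.mul_sum, mul_eq_zero] at h0
    refine mem_derived_iff.2 (hy.1.congr rfl (h0.resolve_left ?_) rfl)
    exact pow_ne_zero _ (mod_cast hp.1.ne_zero)

omit hp in
-- G_k acts on the first level through a cyclic group of order p^{m_k}. After raising to that power,
-- the sections lie in G_{k+1} and the argument repeats.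
theorem exists_pow_mem_levelStab (H : Admissible p m q e) (n k : ℕ) :
    ∃ R, ∀ y ∈ G q e k, y ^ p ^ R ∈ levelStab q k n := by
  induction n generalizing k with
  | zero => exact ⟨0, fun y _ _ => rfl⟩
  | succ n ih =>
    obtain ⟨R, hR⟩ := ih (k + 1)
    refine ⟨m k + R, fun y hy => ?_⟩
    have h1 : y ^ p ^ m k ∈ levelStab q k 1 := by
      obtain ⟨ρ, s, h⟩ := exists_hasCoordinates hy
      obtain ⟨σ, -, g, hg, -⟩ := h.exists_pow (p ^ m k)
      rw [hg, diag_mul_a_zpow_mem, H.card]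
      exact dvd_mul_right _ _
    obtain ⟨h, hh⟩ := exists_diag h1
    have hG : diag q k h ∈ G q e k := hh ▸ pow_mem hy _
    rw [pow_add, pow_mul, hh, ← map_pow]
    exact diag_mem_levelStab.2 fun x => hR _ (section_mem hG x)

end Congruence

/-! ### The lower central series and branching. -/

open scoped commutatorElement

theorem commutator_closure_le {Γ : Type*} [Group Γ] {S : Set Γ} {K : Subgroup Γ}
    (hK : ∀ g ∈ Subgroup.closure S, ∀ x ∈ K, g * x * g⁻¹ ∈ K)
    (hS : ∀ s ∈ S, ∀ t ∈ S, ⁅s, t⁆ ∈ K) :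
    ⁅Subgroup.closure S, Subgroup.closure S⁆ ≤ K := by
  have aux : ∀ y : Γ, (∀ s ∈ S, ⁅s, y⁆ ∈ K) → ∀ x ∈ Subgroup.closure S, ⁅x, y⁆ ∈ K := by
    intro y hy x hx
    induction hx using Subgroup.closure_induction with
    | mem s hs => exact hy s hs
    | one => rw [commutatorElement_one_left]; exact one_mem K
    | mul u v hu hv ihu ihv =>
      rw [show ⁅u * v, y⁆ = u * ⁅v, y⁆ * u⁻¹ * ⁅u, y⁆ by simp only [commutatorElement_def]; group]
      exact mul_mem (hK u hu _ ihv) ihu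
    | inv u hu ihu =>
      rw [show ⁅u⁻¹, y⁆ = u⁻¹ * ⁅u, y⁆⁻¹ * u⁻¹⁻¹ by simp only [commutatorElement_def]; group]
      exact hK _ (inv_mem hu) _ (inv_mem ihu)
  refine Subgroup.commutator_le.2 fun x hx y hy => aux y (fun s hs => ?_) x hx
  rw [← commutatorElement_inv]
  exact inv_mem (aux s (fun t ht => hS t ht s hs) y hy)

section LowerCentral

variable {p : ℕ} [hp : Fact p.Prime] {m : ℕ → ℕ} {q : ℕ → ℕ} {e : Fin (q 0 - 1) → ℤ} {k : ℕ}
  [hq : ∀ k, NeZero (q k)]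

/-- The lower central series of `G_k`, starting with `G_k` in degree `0`. -/
def gam (q : ℕ → ℕ) (e : Fin (q 0 - 1) → ℤ) (k c : ℕ) : Subgroup (AutT q k) :=
  ((⊤ : Subgroup (G q e k)).lowerCentralSeries c).map (G q e k).subtype

omit hq in
theorem gam_zero : gam q e k 0 = G q e k := by
  rw [gam, Subgroup.lowerCentralSeries_zero, ← MonoidHom.range_eq_map, Subgroup.range_subtype]

omit hq in
theorem gam_succ (c : ℕ) : gam q e k (c + 1) = ⁅gam q e k c, G q e k⁆ := by
  conv_rhs => rw [← gam_zero (q := q) (e := e) (k := k)]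
  rw [gam, gam, gam, ← Subgroup.map_commutator]
  rfl

omit hq in
theorem gam_one : gam q e k 1 = ⁅G q e k, G q e k⁆ := by
  rw [gam_succ, gam_zero]

omit hq in
theorem conj_mem_gam (c : ℕ) {g x : AutT q k} (hg : g ∈ G q e k) (hx : x ∈ gam q e k c) :
    g * x * g⁻¹ ∈ gam q e k c := by
  obtain ⟨x, hx, rfl⟩ := hx
  exact ⟨_, Subgroup.Normal.conj_mem inferInstance x hx ⟨g, hg⟩, rfl⟩

/-- The embedding of `Aut T_{k+1}` in `Aut T_k` as the automorphisms supported on the subtree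
rooted at the first-level vertex `x`. -/
def emb (q : ℕ → ℕ) (k : ℕ) (x : Fin (q k)) : AutT q (k + 1) →* AutT q k :=
  (diag q k).comp (MonoidHom.mulSingle (fun _ => AutT q (k + 1)) x)

omit hq in
theorem diag_mem_of_emb_mem {V : Subgroup (AutT q k)} {h : Fin (q k) → AutT q (k + 1)}
    (hh : ∀ x, emb q k x (h x) ∈ V) : diag q k h ∈ V :=
  Subgroup.pi_mem_of_mulSingle_mem (H := V.comap (diag q k)) h hh

omit hq in
theorem conj_emb (h : Fin (q k) → AutT q (k + 1)) (x : Fin (q k)) (u : AutT q (k + 1)) :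
    diag q k h * emb q k x u * (diag q k h)⁻¹ = emb q k x (h x * u * (h x)⁻¹) := by
  simp only [emb, MonoidHom.comp_apply, ← map_inv, ← map_mul, MonoidHom.mulSingle_apply]
  congr 1
  funext y
  by_cases hy : y = x
  · subst hy; simp
  · simp [hy]

omit hq in
theorem commutator_emb (h : Fin (q k) → AutT q (k + 1)) (x : Fin (q k)) (u : AutT q (k + 1)) :
    ⁅emb q k x u, diag q k h⁆ = emb q k x ⁅u, h x⁆ := by
  rw [commutatorElement_def, commutatorElement_def, mul_assoc, mul_assoc, ← mul_assoc (diag q k h),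
    ← map_inv, conj_emb, ← map_mul, mul_assoc, mul_assoc, mul_assoc]

theorem conj_a_zpow_emb (s : ℤ) (x : Fin (q k)) (u : AutT q (k + 1)) :
    a q k ^ s * emb q k x u * (a q k ^ s)⁻¹ = emb q k (x + s • 1) u := by
  rw [emb, MonoidHom.comp_apply, a_zpow_mul_diag, mul_inv_cancel_right]
  change _ = diag q k _
  congr 1
  funext y
  simp only [MonoidHom.mulSingle_apply, Pi.mulSingle_apply, sub_eq_iff_eq_add]

theorem map_emb_derived_le (H : Admissible p m q e) {V : Subgroup (AutT q k)}
    (hV : ∀ g ∈ G q e k, ∀ v ∈ V, g * v * g⁻¹ ∈ V) {j : Fin (q k)} {u : ℤ}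
    (hu : ¬ (p : ℤ) ∣ u) (hj : emb q k j ⁅a q (k + 1) ^ u, b q e (k + 1)⁆ ∈ V) (x : Fin (q k)) :
    (⁅G q e (k + 1), G q e (k + 1)⁆).map (emb q k x) ≤ V := by
  have hx : emb q k x ⁅a q (k + 1) ^ u, b q e (k + 1)⁆ ∈ V := by
    obtain ⟨s, hs⟩ := exists_zsmul_one (x - j)
    have := hV _ (zpow_mem a_mem s) _ hj
    rwa [conj_a_zpow_emb, hs, add_sub_cancel] at this
  -- As u is prime to p, a_{k+1}^u and b_{k+1} still generate, so G_{k+1}' is the normal closure of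
  -- their commutator.
  have hG : G q e (k + 1) = Subgroup.closure {a q (k + 1) ^ u, b q e (k + 1)} := by
    apply le_antisymm
    · refine (Subgroup.closure_le _).2 ?_
      rintro _ (rfl | rfl)
      · exact a_mem_of_zpow_mem H hu (Subgroup.subset_closure (Or.inl rfl))
      · exact Subgroup.subset_closure (Or.inr rfl)
    · refine (Subgroup.closure_le _).2 ?_
      rintro _ (rfl | rfl)
      · exact zpow_mem a_mem u
      · exact b_mem
  rw [Subgroup.map_le_iff_le_comap]
  conv_lhs => rw [hG]
  refine commutator_closure_le (fun g hg v hv => ?_) ?_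
  · rw [← hG] at hg
    obtain ⟨h, hh, rfl⟩ := exists_section H x hg
    rw [Subgroup.mem_comap, ← conj_emb]
    exact hV _ hh _ hv
  · rintro _ (rfl | rfl) _ (rfl | rfl)
    · rw [commutatorElement_self]; exact one_mem _
    · exact hx
    · rw [← commutatorElement_inv]; exact inv_mem hx
    · rw [commutatorElement_self]; exact one_mem _

/-- The shift by j + 1 places b_{k+1} at j, against the power of a_{k+1} there. At the last letter
-1 the section b_{k+1} of b_k meets a trivial section; elsewhere two powers of a_{k+1} commute. -/
theorem commutator_b_conj {j : Fin (q k)} (hj : entry q e k j ≠ 0)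
    (h0 : bSec q e k (-1 - (j + 1)) = 1) :
    ⁅b q e k, diag q k (fun x => bSec q e k (x - (j + 1)))⁆ =
      emb q k j ⁅a q (k + 1) ^ entry q e k j, b q e (k + 1)⁆ := by
  have hj1 : j + 1 ≠ 0 := fun h => hj (entry_of_add_one h)
  rw [b_eq_diag]
  simp only [emb, MonoidHom.comp_apply, commutatorElement_def, ← map_inv, ← map_mul]
  congr 1
  rw [← commutatorElement_def]
  funext x
  change bSec q e k x * bSec q e k (x - (j + 1)) * (bSec q e k x)⁻¹ *
    (bSec q e k (x - (j + 1)))⁻¹ = _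
  by_cases hx : x + 1 = 0
  · obtain rfl : x = -1 := eq_neg_of_add_eq_zero_left hx
    have : (-1 : Fin (q k)) ≠ j := fun h => hj1 (by rw [← h, neg_add_cancel])
    rw [h0]
    simp [this]
  · rw [bSec_of_add_one_ne hx]
    by_cases hxj : x = j
    · subst hxj
      rw [bSec_of_add_one (by abel)]
      simp
    · rw [bSec_of_add_one_ne (x := x - (j + 1))]
      · simp only [MonoidHom.mulSingle_apply, Pi.mulSingle_eq_of_ne hxj, ← zpow_add, ← zpow_neg]
        rw [show ∀ c d : ℤ, c + d + -c + -d = 0 by intros; ring, zpow_zero]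
      · intro h
        exact hxj (sub_eq_zero.1 (by rw [← h]; abel))

omit hq in
-- If f = b_k c with c in G_k', then [b_k, f] is conjugate to [b_k, c], which lies in γ₃(G_k).
-- Degrees of `gam` start at 0, so γ₃ is `gam` in degree 2.
theorem commutator_b_mem_gam_two {f : AutT q k} (hf : HasExponents q e k f 1 0) :
    ⁅b q e k, f⁆ ∈ gam q e k 2 := by
  have hc : (b q e k)⁻¹ * f ∈ gam q e k 1 := by
    rw [gam_one, mem_derived_iff]
    exact ((HasExponents.b_zpow 1).inv.mul hf).congr (by rw [zpow_one]) (by ring) (by ring)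
  rw [show ⁅b q e k, f⁆ = b q e k * ⁅(b q e k)⁻¹ * f, b q e k⁆⁻¹ * (b q e k)⁻¹ by
    simp only [commutatorElement_def]; group]
  refine conj_mem_gam 2 b_mem (inv_mem ?_)
  rw [gam_succ]
  exact Subgroup.commutator_mem_commutator hc b_mem

/-- If the vector of sections of `b_k` is not symmetric modulo `p`, witnessed by a position whose
mirror image carries the trivial section, then `γ₃(G_k)` contains `G_{k+1}' × ⋯ × G_{k+1}'`. -/
theorem map_emb_derived_le_gam_two (H : Admissible p m q e) {j : Fin (q k)}
    (hj : ¬ (p : ℤ) ∣ entry q e k j) (h0 : bSec q e k (-1 - (j + 1)) = 1) (x : Fin (q k)) :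
    (⁅G q e (k + 1), G q e (k + 1)⁆).map (emb q k x) ≤ gam q e k 2 := by
  refine map_emb_derived_le H (fun g hg v hv => conj_mem_gam 2 hg hv) (j := j) hj ?_ x
  rw [← commutator_b_conj (fun h => hj (h ▸ dvd_zero _)) h0]
  exact commutator_b_mem_gam_two (hasExponents_diag_bSec_sub _)

/-- A commutator with g in the subtree at x equals a commutator with any element of G_k that fixes
the first level and has section g at x. Each such commutator adds one degree in both groups. -/
theorem map_emb_gam_le (H : Admissible p m q e) {d : ℕ} {x : Fin (q k)}
    (hd : (⁅G q e (k + 1), G q e (k + 1)⁆).map (emb q k x) ≤ gam q e k d) (c : ℕ) :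
    (gam q e (k + 1) (c + 1)).map (emb q k x) ≤ gam q e k (d + c) := by
  induction c with
  | zero => rwa [gam_one]
  | succ c ih =>
    rw [gam_succ, Subgroup.map_le_iff_le_comap, Subgroup.commutator_le]
    intro u hu g hg
    obtain ⟨h, hh, rfl⟩ := exists_section H x hg
    rw [Subgroup.mem_comap, ← commutator_emb, ← add_assoc, gam_succ]
    exact Subgroup.commutator_mem_commutator (ih ⟨u, hu, rfl⟩) hh

/-- The subgroup generated by the `n`-th powers in `G_k'`. -/
def powDerived (q : ℕ → ℕ) (e : Fin (q 0 - 1) → ℤ) (k n : ℕ) : Subgroup (AutT q k) :=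
  Subgroup.closure ((fun g => g ^ n) '' (⁅G q e k, G q e k⁆ : Subgroup (AutT q k)))

omit hq in
theorem map_emb_powDerived_le {x : Fin (q k)}
    (hd : (⁅G q e (k + 1), G q e (k + 1)⁆).map (emb q k x) ≤ ⁅G q e k, G q e k⁆) (n : ℕ) :
    (powDerived q e (k + 1) n).map (emb q k x) ≤ powDerived q e k n := by
  rw [powDerived, MonoidHom.map_closure]
  refine (Subgroup.closure_le _).2 ?_
  rintro _ ⟨_, ⟨g, hg, rfl⟩, rfl⟩
  exact Subgroup.subset_closure ⟨emb q k x g, hd ⟨g, hg, rfl⟩, (map_pow _ g n).symm⟩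

omit hq in
theorem gam_antitone : Antitone (gam q e k) := fun _ _ h =>
  Subgroup.map_mono (Subgroup.lowerCentralSeries_antitone _ h)

/-- The congruence property of `G_k'` modulo the lower central series and powers. -/
theorem exists_derived_inf_levelStab_le (H : Admissible p m q e) (hS : StabCondition q e)
    (hγ : ∀ k x, (⁅G q e (k + 2), G q e (k + 2)⁆).map (emb q (k + 1) x) ≤ gam q e (k + 1) 2)
    (j c k : ℕ) : ∃ M, ∀ f ∈ ⁅G q e (k + 1), G q e (k + 1)⁆, f ∈ levelStab q (k + 1) M →
      f ∈ gam q e (k + 1) (c + 1) ⊔ powDerived q e (k + 1) (p ^ j) := by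
  induction c generalizing k with
  | zero =>
    refine ⟨0, fun f hf _ => Subgroup.mem_sup_left ?_⟩
    rwa [gam_one]
  | succ c ih =>
    obtain ⟨M₁, hM₁⟩ := ih (k + 1)
    -- The exponent R + j serves two purposes: R makes the power of y deep, so that diag(h) inherits
    -- the depth of f, and j leaves it a p^j-th power.
    obtain ⟨R, hR⟩ := exists_pow_mem_levelStab (e := e) H (M₁ + 1) (k + 1)
    obtain ⟨M, hM⟩ := exists_pow_mul_diag H hS (R + j) (k + 1)
    refine ⟨max M (M₁ + 1), fun f hf hfM => ?_⟩
    obtain ⟨y, hy, h, rfl, hh, hyd⟩ := hM f (derived_le hf)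
      (levelStab_antitone _ (le_max_left _ _) hfM)
    have hyM : y ^ p ^ (R + j) ∈ levelStab q (k + 1) (M₁ + 1) := by
      rw [pow_add, pow_mul]
      exact pow_mem (hR y hy) _
    have hhM := (Subgroup.mul_mem_cancel_right _ hyM).1
      (levelStab_antitone _ (le_max_right _ _) hfM)
    rw [diag_mem_levelStab] at hhM
    refine mul_mem (diag_mem_of_emb_mem fun x => ?_) (Subgroup.mem_sup_right ?_)
    · have hx : emb q (k + 1) x (h x) ∈
          (gam q e (k + 2) (c + 1) ⊔ powDerived q e (k + 2) (p ^ j)).map (emb q (k + 1) x) :=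
        ⟨_, hM₁ _ (hh x) (hhM x), rfl⟩
      rw [Subgroup.map_sup] at hx
      -- Embedding in γ₃ rather than in G_{k+1}' is what raises the degree from c + 1 to c + 2.
      refine sup_le_sup ((map_emb_gam_le H (hγ k x) c).trans_eq ?_)
        (map_emb_powDerived_le ((hγ k x).trans ?_) _) hx
      · rw [show 2 + c = c + 1 + 1 by ring]
      · rw [← gam_one]
        exact gam_antitone (by norm_num)
    · rw [add_comm R j, pow_add, mul_comm, pow_mul]
      exact Subgroup.subset_closure ⟨y ^ p ^ R, pow_mem (hyd hf) _, rfl⟩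

omit hq in
-- The quotient by N is a finite p-group, hence nilpotent.
theorem exists_gam_le {N : Subgroup (G q e k)} [N.Normal] {j : ℕ} (hN : N.index = p ^ j) :
    ∃ c, gam q e k (c + 1) ≤ N.map (G q e k).subtype := by
  have hcard : Nat.card (G q e k ⧸ N) = p ^ j := hN
  have : Finite (G q e k ⧸ N) := Nat.finite_of_card_ne_zero
    (hcard ▸ pow_ne_zero _ hp.1.ne_zero)
  have : Group.IsNilpotent (G q e k ⧸ N) := (IsPGroup.of_card hcard).isNilpotent
  obtain ⟨c, hc⟩ := Subgroup.nilpotent_iff_lowerCentralSeries.1 this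
  refine ⟨c, (gam_antitone (Nat.le_succ c)).trans (Subgroup.map_mono ?_)⟩
  have := Subgroup.map_lowerCentralSeries (⊤ : Subgroup (G q e k)) (QuotientGroup.mk' N) c
  rw [Subgroup.map_top_of_surjective _ (QuotientGroup.mk'_surjective N), hc,
    Subgroup.map_eq_bot_iff, QuotientGroup.ker_mk'] at this
  exact this

theorem hasPCongruenceSubgroupProperty (H : Admissible p m q e) (hS : StabCondition q e)
    (hD : ∀ x, (⁅G q e 1, G q e 1⁆).map (emb q 0 x) ≤ ⁅G q e 0, G q e 0⁆)
    (hγ : ∀ k x, (⁅G q e (k + 2), G q e (k + 2)⁆).map (emb q (k + 1) x) ≤ gam q e (k + 1) 2) :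
    HasPCongruenceSubgroupProperty p (G q e 0) := by
  rintro N hN ⟨j, hj⟩
  have hpow : ∀ y ∈ G q e 0, y ^ p ^ j ∈ N.map (G q e 0).subtype := fun y hy =>
    ⟨_, hj ▸ N.pow_index_mem ⟨y, hy⟩, rfl⟩
  obtain ⟨c, hc⟩ := exists_gam_le hj
  obtain ⟨M₁, hM₁⟩ := exists_derived_inf_levelStab_le H hS hγ j (c + 1) 0
  obtain ⟨R, hR⟩ := exists_pow_mem_levelStab (e := e) H (M₁ + 1) 0
  obtain ⟨M, hM⟩ := exists_pow_mul_diag H hS (R + j) 0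
  refine ⟨max M (M₁ + 1), ?_⟩
  rintro ⟨f, hf⟩ (hfM : f ∈ levelStab q 0 _)
  suffices f ∈ N.map (G q e 0).subtype by
    obtain ⟨f', hf', rfl⟩ := this
    exact hf'
  obtain ⟨y, hy, h, rfl, hh, -⟩ := hM f hf (levelStab_antitone _ (le_max_left _ _) hfM)
  have hyM : y ^ p ^ (R + j) ∈ levelStab q 0 (M₁ + 1) := by
    rw [pow_add, pow_mul]
    exact pow_mem (hR y hy) _
  have hhM := (Subgroup.mul_mem_cancel_right _ hyM).1
    (levelStab_antitone _ (le_max_right _ _) hfM)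
  rw [diag_mem_levelStab] at hhM
  refine mul_mem (diag_mem_of_emb_mem fun x => ?_) ?_
  · have hx : emb q 0 x (h x) ∈
        (gam q e 1 (c + 1 + 1) ⊔ powDerived q e 1 (p ^ j)).map (emb q 0 x) :=
      ⟨_, hM₁ _ (hh x) (hhM x), rfl⟩
    rw [Subgroup.map_sup] at hx
    refine (sup_le ?_ ?_ : _ ≤ N.map (G q e 0).subtype) hx
    · refine (map_emb_gam_le (d := 1) H ((hD x).trans_eq gam_one.symm) (c + 1)).trans
        ((gam_antitone ?_).trans hc)
      omega
    · refine (map_emb_powDerived_le (hD x) _).trans ((Subgroup.closure_le _).2 ?_)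
      rintro _ ⟨g, hg, rfl⟩
      exact hpow g (derived_le hg)
  · rw [pow_add, pow_mul]
    exact hpow _ (pow_mem hy _)

end LowerCentral

/-! ### Non-symmetry of the padded vector. -/

section Application

variable {p : ℕ} [hp : Fact p.Prime] {m : ℕ → ℕ} {q : ℕ → ℕ} {e : Fin (q 0 - 1) → ℤ} {k : ℕ}
  [hq : ∀ k, NeZero (q k)]

omit hq in
theorem map_emb_derived_le_of_derivedCondition (hD : DerivedCondition q e) (k : ℕ)
    (x : Fin (q k)) : (⁅G q e (k + 1), G q e (k + 1)⁆).map (emb q k x) ≤ ⁅G q e k, G q e k⁆ := by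
  rintro _ ⟨g, hg, rfl⟩
  have hmem : Pi.mulSingle x g ∈ Subgroup.pi Set.univ
      (fun _ : Fin (q k) => ⁅G q e (k + 1), G q e (k + 1)⁆) :=
    (Subgroup.mulSingle_mem_pi (H := fun _ : Fin (q k) => ⁅G q e (k + 1), G q e (k + 1)⁆) x g).2
      fun _ => hg
  obtain ⟨f, hf, hfg⟩ := hD k hmem
  have : emb q k x g = f := (congrArg (diag q k) hfg.symm).trans (diag_psi1 f)
  rw [this]
  exact hf

omit hq in
theorem derivedCondition_of_map_emb_derived_le (h : ∀ k (x : Fin (q k)),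
    (⁅G q e (k + 1), G q e (k + 1)⁆).map (emb q k x) ≤ ⁅G q e k, G q e k⁆) :
    DerivedCondition q e := fun k f hf =>
  ⟨⟨diag q k f, diag_mem f⟩,
    diag_mem_of_emb_mem fun x => h k x ⟨f x, hf x (Set.mem_univ x), rfl⟩, psi1_diag f⟩

omit hq in
theorem bSec_eq_one {x : Fin (q k)} (h1 : x.val + 1 ≠ q k) (h2 : entry q e k x = 0) :
    bSec q e k x = 1 := by
  rw [bSec, if_neg h1, h2, zpow_zero]

/-- With letters numbered from 0, the mirror image exchanges positions j and n - 2 - j and leaves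
out the last letter. -/
theorem val_mirror {n : ℕ} [NeZero n] {j : Fin n} (hj : j.val + 2 ≤ n) :
    (-1 - (j + 1)).val = n - 2 - j.val := by
  have h1 : (j + 1).val = j.val + 1 := by
    rw [Fin.val_add, Fin.val_one', Nat.add_mod_mod, Nat.mod_eq_of_lt (by omega)]
  have : -1 - (j + 1) = ⟨n - 2 - j.val, by omega⟩ := by
    rw [eq_comm, eq_sub_iff_add_eq, eq_neg_iff_add_eq_zero, ← val_add_one_eq_iff, Fin.val_add,
      h1, Nat.mod_eq_of_lt]
    all_goals
      dsimp only
      omega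
  rw [this]

omit hq in
theorem entry_of_lt (i : Fin (q 0 - 1)) (h : i.val + 1 < q k) :
    entry q e k ⟨i, by omega⟩ = e i := by
  rw [entry, if_neg h.ne, dif_pos i.2]

omit hq in
theorem entry_of_le {x : Fin (q k)} (h2 : q 0 - 1 ≤ x.val) : entry q e k x = 0 := by
  rw [entry, dif_neg (not_lt.2 h2), ite_self]

omit hq in
theorem Admissible.of_exists (hqm : ∀ k, q k = p ^ m k) (hm : StrictMono m)
    (he : ∃ i, ¬ (p : ℤ) ∣ e i) : Admissible p m q e where
  card := hqm
  mono := hm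
  unit k := by
    obtain ⟨i, hi⟩ := he
    have hi' := i.2
    have : q 0 ≤ q k := by
      rw [hqm, hqm]
      exact Nat.pow_le_pow_right hp.1.pos (hm.monotone (Nat.zero_le k))
    refine ⟨⟨i, by omega⟩, ?_⟩
    rwa [entry_of_lt i (by omega)]

/-- The nonzero entries occupy the first q_0 - 1 positions, so in a long enough tuple the mirror
image of such a position falls in the padding. -/
theorem map_emb_derived_le_gam_two_of_three_mul_le (H : Admissible p m q e)
    (he : ∃ i, ¬ (p : ℤ) ∣ e i) (hk : 3 * q 0 ≤ q k) (x : Fin (q k)) :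
    (⁅G q e (k + 1), G q e (k + 1)⁆).map (emb q k x) ≤ gam q e k 2 := by
  obtain ⟨i, hi⟩ := he
  have hi' := i.2
  have hv : (-1 - ((⟨i, by omega⟩ : Fin (q k)) + 1)).val = q k - 2 - i :=
    val_mirror (by change i.val + 2 ≤ q k; omega)
  refine map_emb_derived_le_gam_two H (j := ⟨i, by omega⟩) ?_ ?_ x
  · rwa [entry_of_lt i (by omega)]
  · exact bSec_eq_one (by omega) (entry_of_le (by omega))

omit hq hp in
theorem Admissible.three_mul_le (H : Admissible p m q e) (h3 : 3 ≤ p) (hk : 0 < k) :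
    3 * q 0 ≤ q k := by
  rw [H.card, H.card]
  calc 3 * p ^ m 0 ≤ p * p ^ m 0 := Nat.mul_le_mul_right _ h3
    _ = p ^ (m 0 + 1) := (pow_succ' _ _).symm
    _ ≤ p ^ m k := Nat.pow_le_pow_right (by omega) (H.mono hk)

omit hq hp in
theorem exists_not_dvd {N : ℕ} {e : Fin N → ℤ} (h : NonconstantMod p e) :
    ∃ i, ¬ (p : ℤ) ∣ e i := by
  by_contra! hall
  obtain ⟨i, j, hij⟩ := h
  exact hij ((Int.modEq_zero_iff_dvd.2 (hall i)).trans (Int.modEq_zero_iff_dvd.2 (hall j)).symm)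

theorem hasPCongruenceSubgroupProperty_of_nonconstantMod (h3 : 3 ≤ p)
    (hqm : ∀ k, q k = p ^ m k) (hm : StrictMono m) (hD : DerivedCondition q e)
    (hS : StabCondition q e) (he : NonconstantMod p e) :
    HasPCongruenceSubgroupProperty p (G q e 0) := by
  have he' := exists_not_dvd he
  have H := Admissible.of_exists hqm hm he'
  exact hasPCongruenceSubgroupProperty H hS (map_emb_derived_le_of_derivedCondition hD 0)
    fun k => map_emb_derived_le_gam_two_of_three_mul_le H he' (H.three_mul_le h3 k.succ_pos)

end Application

/-! ### The growing Gupta–Sidki group. -/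

section GuptaSidki

variable {p : ℕ} [hp : Fact p.Prime] {m : ℕ → ℕ} {q : ℕ → ℕ} {k : ℕ} [hq : ∀ k, NeZero (q k)]

theorem entry_guptaSidkiVector (h0 : 3 ≤ q 0) (hk : 3 ≤ q k) (x : Fin (q k)) :
    entry q (guptaSidkiVector (q 0 - 1)) k x =
      (if x = 0 then 1 else 0) - (if x = 1 then 1 else 0) := by
  have h1 : (1 : Fin (q k)).val = 1 := by
    rw [Fin.val_one', Nat.mod_eq_of_lt (by omega)]
  simp only [entry, guptaSidkiVector, Fin.ext_iff, h1, Fin.val_zero]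
  split_ifs <;> omega

theorem conv_guptaSidkiVector (h0 : 3 ≤ q 0) (hk : 3 ≤ q k) (ρ : Fin (q k) → ℤ)
    (x : Fin (q k)) :
    conv q (guptaSidkiVector (q 0 - 1)) k ρ x = ρ x - ρ (x - 1) := by
  have h : ∀ t : Fin (q k), x - t = 1 ↔ x - 1 = t := fun t => by
    rw [sub_eq_iff_eq_add, sub_eq_iff_eq_add, add_comm]
  simp [conv, entry_guptaSidkiVector h0 hk, mul_sub, Finset.sum_sub_distrib, sub_eq_zero, h]

omit hp in
-- Convolution with (1, -1, 0, …) takes differences of neighbouring coordinates. For an element of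
-- the second level stabiliser these are divisible by q_{k+1}, hence by q_k; so ρ is constant modulo
-- q_k and its q_k terms sum to 0 modulo q_k.
theorem stabCondition_guptaSidkiVector (hqm : ∀ k, q k = p ^ m k) (hm : StrictMono m)
    (hq3 : ∀ k, 3 ≤ q k) : StabCondition q (guptaSidkiVector (q 0 - 1)) := by
  rintro k f ⟨hf, hfS⟩
  rw [mem_zpowers_b_sup_derived_iff]
  obtain ⟨h, rfl, hh⟩ := exists_diag_of_mem_levelStab hfS
  obtain ⟨ρ, hρ⟩ := exists_hasCoordinates_diag hf
  refine ⟨_, hρ.1, ?_⟩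
  have hstep : ∀ x, (q k : ℤ) ∣ ρ x - ρ (x - 1) := by
    intro x
    rw [← conv_guptaSidkiVector (hq3 0) (hq3 k)]
    refine dvd_trans ?_ (dvd_of_mem_levelStab (hρ.hasExponents x) (hh x))
    rw [hqm, hqm, Int.natCast_dvd_natCast]
    exact pow_dvd_pow _ (hm k.lt_succ_self).le
  have hall : ∀ i : ℕ, (q k : ℤ) ∣ ρ (i • 1) - ρ 0 := by
    intro i
    induction i with
    | zero => simp
    | succ i ih =>
      have := dvd_add (hstep ((i + 1) • 1)) ih
      rwa [succ_nsmul, add_sub_cancel_right, sub_add_sub_cancel] at this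
  have hsum : ∑ t, ρ t = ∑ t, (ρ t - ρ 0) + q k * ρ 0 := by
    simp [Finset.sum_sub_distrib]
  rw [hsum]
  refine dvd_add (Finset.dvd_sum fun t _ => ?_) (dvd_mul_right _ _)
  have := hall t.val
  rwa [show (t.val • 1 : Fin (q k)) = t from
    Fin.ext (by rw [val_nsmul_one, Nat.mod_eq_of_lt t.2])] at this

theorem fin_three_cases {n : ℕ} [NeZero n] (hn : n = 3) :
    (1 : Fin n) + 1 = -1 ∧ (-1 : Fin n) - 1 = 1 ∧ (1 : Fin n) ≠ 0 ∧ (-1 : Fin n) ≠ 0 ∧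
      ∀ x : Fin n, x = 0 ∨ x = 1 ∨ x = -1 := by
  have h : (1 : Fin 3) + 1 = -1 ∧ (-1 : Fin 3) - 1 = 1 ∧ (1 : Fin 3) ≠ 0 ∧ (-1 : Fin 3) ≠ 0 ∧
      ∀ x : Fin 3, x = 0 ∨ x = 1 ∨ x = -1 := by decide
  subst hn
  exact h

/-- The derived condition for the Gupta-Sidki vector at a ternary vertex. -/
theorem map_emb_derived_le_of_eq_three (hp3 : 3 ≤ p) (h0 : 3 ≤ q 0) (hk : q k = 3)
    (H : Admissible p m q (guptaSidkiVector (q 0 - 1))) (x : Fin (q k)) :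
    (⁅G q (guptaSidkiVector (q 0 - 1)) (k + 1), G q (guptaSidkiVector (q 0 - 1)) (k + 1)⁆).map
      (emb q k x) ≤ ⁅G q (guptaSidkiVector (q 0 - 1)) k, G q (guptaSidkiVector (q 0 - 1)) k⁆ := by
  set e := guptaSidkiVector (q 0 - 1) with he
  obtain ⟨f1, f2, f3, f4, f5⟩ := fin_three_cases hk
  have s0 : bSec q e k 0 = a q (k + 1) := by
    rw [bSec_of_add_one_ne (by rwa [zero_add]), entry_guptaSidkiVector h0 hk.ge, if_pos rfl,
      if_neg f3.symm, sub_zero, zpow_one]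
  have s1 : bSec q e k 1 = (a q (k + 1))⁻¹ := by
    rw [bSec_of_add_one_ne (by rwa [f1]), entry_guptaSidkiVector h0 hk.ge, if_neg f3,
      if_pos rfl, zero_sub, zpow_neg_one]
  have s2 : bSec q e k (-1) = b q e (k + 1) := bSec_of_add_one (neg_add_cancel _)
  let β : Fin (q k) → Fin (q k) → AutT q (k + 1) := fun c x => bSec q e k (x - c)
  have hβ : ∀ c, diag q k (β c) ∈ G q e k := diag_bSec_sub_mem
  have hβ2 : ∀ c d, diag q k (β c * β d) ∈ G q e k := fun c d => by
    rw [map_mul]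
    exact mul_mem (hβ c) (hβ d)
  have hconj : ∀ g ∈ G q e k, ∀ v ∈ ⁅G q e k, G q e k⁆, g * v * g⁻¹ ∈ ⁅G q e k, G q e k⁆ := by
    intro g hg v hv
    rw [← gam_one] at hv ⊢
    exact conj_mem_gam 1 hg hv
  -- In the order 0, 1, -1 the factors have sections (ba, 1, a⁻¹b) and (ba⁻¹, ab, 1), so only
  -- position 0 contributes. There [ba, ba⁻¹] is the conjugate of [b, a⁻²] by ba, and -2 is prime to
  -- p.
  have key : ⁅β 1 * β 0, β 1 * β (-1)⁆ = Pi.mulSingle 0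
      ((β 1 * β 0) 0 * ⁅b q e (k + 1), a q (k + 1) ^ (-2 : ℤ)⁆ * ((β 1 * β 0) 0)⁻¹) := by
    funext y
    rw [commutatorElement_def]
    simp only [Pi.mul_apply, Pi.inv_apply, β]
    rcases f5 y with rfl | rfl | rfl
    · simp only [zero_sub, sub_zero, neg_neg, s0, s1, s2, Pi.mulSingle_eq_same,
        commutatorElement_def]
      group
    · rw [Pi.mulSingle_eq_of_ne f3]
      simp only [sub_self, sub_zero, sub_neg_eq_add, f1, s0, s1, s2]
      group
    · rw [Pi.mulSingle_eq_of_ne f4]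
      simp only [sub_self, sub_zero, f2, s0, s1, s2]
      group
  refine map_emb_derived_le H hconj (j := 0) (u := -2) ?_ ?_ x
  · rw [dvd_neg]
    exact fun h => absurd (Int.le_of_dvd two_pos h) (by omega)
  · have h1 : emb q k 0 ((β 1 * β 0) 0 * ⁅b q e (k + 1), a q (k + 1) ^ (-2 : ℤ)⁆ *
        ((β 1 * β 0) 0)⁻¹) ∈ ⁅G q e k, G q e k⁆ := by
      refine (congrArg (diag q k) key).symm ▸ ?_
      rw [map_commutatorElement]
      exact Subgroup.commutator_mem_commutator (hβ2 _ _) (hβ2 _ _)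
    have h2 := hconj _ (inv_mem (hβ2 1 0)) _ h1
    rw [← conj_emb, inv_inv] at h2
    rw [← commutatorElement_inv, map_inv]
    refine inv_mem ?_
    convert h2 using 1
    group

/-- The mirror image of position 0 is q_k - 2, whose section is trivial once q_k > 3. For q_k = 3 it
is position 1, which carries the entry -1, so that case needs a separate commutator. -/
theorem derivedCondition_guptaSidkiVector (hp3 : 3 ≤ p) (hq3 : ∀ k, 3 ≤ q k)
    (H : Admissible p m q (guptaSidkiVector (q 0 - 1))) :
    DerivedCondition q (guptaSidkiVector (q 0 - 1)) := by
  refine derivedCondition_of_map_emb_derived_le fun k x => ?_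
  rcases (hq3 k).eq_or_lt with hk | hk
  · exact map_emb_derived_le_of_eq_three hp3 (hq3 0) hk.symm H x
  · have h1 : (1 : Fin (q k)).val = 1 := by
      rw [Fin.val_one', Nat.mod_eq_of_lt (by omega)]
    have hv : (-1 - ((0 : Fin (q k)) + 1)).val = q k - 2 := val_mirror (by simp; omega)
    rw [← gam_one (k := k)]
    refine (map_emb_derived_le_gam_two H (j := 0) ?_ (bSec_eq_one (by omega) ?_) x).trans
      (gam_antitone one_le_two)
    · rw [entry_guptaSidkiVector (hq3 0) (hq3 k), if_pos rfl,
        if_neg (by rw [Fin.ext_iff, h1, Fin.val_zero]; omega), sub_zero]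
      exact fun h => absurd (Int.le_of_dvd one_pos h) (by omega)
    · rw [entry_guptaSidkiVector (hq3 0) (hq3 k),
        if_neg (by rw [Fin.ext_iff, hv, Fin.val_zero]; omega),
        if_neg (by rw [Fin.ext_iff, hv, h1]; omega), sub_zero]

end GuptaSidki

theorem isDefiningVector_guptaSidkiVector {q : ℕ → ℕ} (h0 : 3 ≤ q 0) (h1 : 2 ≤ q 1) :
    IsDefiningVector q (guptaSidkiVector (q 0 - 1)) := by
  refine ⟨⟨⟨0, by omega⟩, by simp [guptaSidkiVector]⟩, fun i => ?_⟩
  have : |guptaSidkiVector (q 0 - 1) i| ≤ 1 := by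
    unfold guptaSidkiVector
    split_ifs <;> simp
  omega

theorem nonconstantMod_guptaSidkiVector {p N : ℕ} (hp : 3 ≤ p) (hN : 2 ≤ N) :
    NonconstantMod p (guptaSidkiVector N) := by
  refine ⟨⟨0, by omega⟩, ⟨1, by omega⟩, fun h => ?_⟩
  have := Int.le_of_dvd (by simp [guptaSidkiVector]) h.symm.dvd
  simp [guptaSidkiVector] at this
  omega

end GrowingGGS

/-! ### The main theorem. -/

theorem mainTheorem4 (p : ℕ) (hp : p.Prime) (hodd : Odd p)
    (m : ℕ → ℕ) (hpos : 0 < m 0) (hm : StrictMono m) :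
    (∀ e : Fin (p ^ m 0 - 1) → ℤ,
      GrowingGGS.IsDefiningVector (fun i => p ^ m i) e →
      GrowingGGS.DerivedCondition (fun i => p ^ m i) e →
      GrowingGGS.StabCondition (fun i => p ^ m i) e →
      GrowingGGS.NonconstantMod p e →
      GrowingGGS.HasPCongruenceSubgroupProperty p (GrowingGGS.G (fun i => p ^ m i) e 0)) ∧
    (GrowingGGS.IsDefiningVector (fun i => p ^ m i)
        (GrowingGGS.guptaSidkiVector (p ^ m 0 - 1)) ∧
      GrowingGGS.DerivedCondition (fun i => p ^ m i)
        (GrowingGGS.guptaSidkiVector (p ^ m 0 - 1)) ∧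
      GrowingGGS.StabCondition (fun i => p ^ m i)
        (GrowingGGS.guptaSidkiVector (p ^ m 0 - 1)) ∧
      GrowingGGS.NonconstantMod p (GrowingGGS.guptaSidkiVector (p ^ m 0 - 1)) ∧
      GrowingGGS.HasPCongruenceSubgroupProperty p
        (GrowingGGS.G (fun i => p ^ m i)
          (GrowingGGS.guptaSidkiVector (p ^ m 0 - 1)) 0)) := by
  have : Fact p.Prime := ⟨hp⟩
  have hp3 : 3 ≤ p := by
    obtain ⟨r, rfl⟩ := hodd
    have := hp.two_le
    omega
  have hq3 : ∀ k, 3 ≤ p ^ m k := fun k => hp3.trans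
    (Nat.le_self_pow (hpos.trans_le (hm.monotone (Nat.zero_le k))).ne' p)
  have : ∀ k, NeZero ((fun i => p ^ m i) k) := fun k => ⟨pow_ne_zero _ hp.ne_zero⟩
  have main : ∀ e : Fin (p ^ m 0 - 1) → ℤ,
      GrowingGGS.DerivedCondition (fun i => p ^ m i) e →
      GrowingGGS.StabCondition (fun i => p ^ m i) e →
      GrowingGGS.NonconstantMod p e →
      GrowingGGS.HasPCongruenceSubgroupProperty p (GrowingGGS.G (fun i => p ^ m i) e 0) :=
    fun e => GrowingGGS.hasPCongruenceSubgroupProperty_of_nonconstantMod (q := fun i => p ^ m i)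
      hp3 (fun _ => rfl) hm
  have hN := GrowingGGS.nonconstantMod_guptaSidkiVector hp3 (Nat.le_sub_one_of_lt (hq3 0))
  have hD := GrowingGGS.derivedCondition_guptaSidkiVector (q := fun i => p ^ m i) hp3 hq3
    (.of_exists (fun _ => rfl) hm (GrowingGGS.exists_not_dvd hN))
  have hS := GrowingGGS.stabCondition_guptaSidkiVector (q := fun i => p ^ m i) (fun _ => rfl) hm hq3
  exact ⟨fun e _ => main e,
    GrowingGGS.isDefiningVector_guptaSidkiVector (q := fun i => p ^ m i) (hq3 0)
      (le_trans (by norm_num) (hq3 1)), hD, hS, hN, main _ hD hS hN⟩
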